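/- Let $p$ be a prime number, let $K$ be a field of characteristic $p$, and let $\nu$ be a valuation of $K$ with valuation ring $(V,\mathfrak m_\nu,\kappa_\nu)$ and value group $\Gamma_\nu=\nu(K^\times)$, written additively. Let $(R,\mathfrak m_R,\kappa_R)$ be a Noetherian local domain with fraction field $K$ on which $\nu$ is centered, that is, $R\subseteq V$ and $\mathfrak m_\nu\cap R=\mathfrak m_R$; then $\kappa_\nu$ is an extension field of $\kappa_R$. Assume that $[\kappa_R:\kappa_R^p]<\infty$. Then $\dim R$ is finite, and the following hold. 1. $[\Gamma_\nu:p\Gamma_\nu]\,[\kappa_\nu:\kappa_\nu^p]\le p^{\dim R}\,[\kappa_R:\kappa_R^p]$; in particular both factors on the left are finite. 2. $R$ is an Abhyankar center of $\nu$ if and only if $[\Gamma_\nu:p\Gamma_\nu]\,[\kappa_\nu:\kappa_\nu^p]= p^{\dim R}\,[\kappa_R:\kappa_R^p]$. Here $R$ is called an Abhyankar center of $\nu$ if $\dim_{\mathbb Q}(\mathbb Q\otimes_{\mathbb Z}\Gamma_\nu)+\operatorname{tr.deg}(\kappa_\nu/\kappa_R)=\dim R$. -/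

import Mathlib

open scoped TensorProduct

noncomputable section

namespace AbhyankarCenter

variable {K : Type*} [Field K] {Γ₀ : Type*} [LinearOrderedCommGroupWithZero Γ₀]

/-- The value group `Γ_ν = ν(Kˣ)` of a valuation `ν` of a field `K`, written additively.
(It is the group of values that are actually attained: `ν` need not be surjective.) -/
abbrev ValueGroup (ν : Valuation K Γ₀) : Type _ :=
  Additive (MonoidWithZeroHom.valueGroup (.ofClass ν : K →*₀ Γ₀))

/-- `Γ_ν` consists exactly of the values of the nonzero elements of `K`. -/
theorem mem_valueGroup_iff (ν : Valuation K Γ₀) (g : Γ₀ˣ) :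
    g ∈ MonoidWithZeroHom.valueGroup (.ofClass ν : K →*₀ Γ₀) ↔ ∃ x : K, x ≠ 0 ∧ ν x = g := by
  rw [MonoidWithZeroHom.mem_valueGroup_iff_of_comm]
  constructor
  · rintro ⟨a, ha, x, hx⟩
    have ha' : a ≠ 0 := fun h => ha (by simp [h])
    have hx2 : ν a * g = ν x := hx
    have ha2 : ν a ≠ 0 := ha
    have hx' : ν x ≠ 0 := by
      rw [← hx2]; exact mul_ne_zero ha2 g.ne_zero
    refine ⟨a⁻¹ * x, mul_ne_zero (inv_ne_zero ha') (fun h => hx' (by simp [h])), ?_⟩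
    rw [map_mul, map_inv₀, ← hx2, inv_mul_cancel_left₀ ha2]
  · rintro ⟨x, _, h⟩
    exact ⟨1, by simp, x, by simpa using h.symm⟩

/-- The rational rank `dim_ℚ (ℚ ⊗_ℤ Γ)` of an abelian group, with value `⊤` if it is infinite. -/
def rationalRank (Γ : Type*) [AddCommGroup Γ] : ℕ∞ :=
  Cardinal.toENat (Module.rank ℚ (ℚ ⊗[ℤ] Γ))

/-- The index `[Γ : pΓ]`, with value `⊤` if it is infinite. -/
def mulIndex (p : ℕ) (Γ : Type*) [AddCommGroup Γ] : ℕ∞ :=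
  ENat.card (Γ ⧸ (nsmulAddMonoidHom (α := Γ) p).range)

/-- The subfield of `L` generated by the `p`-th powers. If `L` has characteristic `p`, it is
`L^p`, the set of all `p`-th powers; see `mem_frobeniusSubfield_iff`. -/
def frobeniusSubfield (p : ℕ) (L : Type*) [Field L] : Subfield L :=
  Subfield.closure (Set.range fun x : L => x ^ p)

theorem frobeniusSubfield_eq (p : ℕ) (L : Type*) [Field L] [ExpChar L p] :
    frobeniusSubfield p L = (frobenius L p).fieldRange := by
  apply le_antisymm
  · rw [frobeniusSubfield, Subfield.closure_le]
    rintro _ ⟨x, rfl⟩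
    exact ⟨x, rfl⟩
  · rintro _ ⟨x, rfl⟩
    exact Subfield.subset_closure ⟨x, rfl⟩

theorem mem_frobeniusSubfield_iff (p : ℕ) (L : Type*) [Field L] [ExpChar L p] (y : L) :
    y ∈ frobeniusSubfield p L ↔ ∃ x : L, x ^ p = y := by
  rw [frobeniusSubfield_eq]
  rfl

/-- The residue field of a local domain whose fraction field has prime characteristic `p` has
characteristic `p`. -/
theorem charP_residueField (p : ℕ) [Fact p.Prime] [CharP K p] (A : Type*) [CommRing A]
    [IsLocalRing A] [Algebra A K] [IsFractionRing A K] :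
    CharP (IsLocalRing.ResidueField A) p := by
  have : CharP A p := (RingHom.charP_iff (algebraMap A K) (IsFractionRing.injective A K) p).2 ‹_›
  have h : ((p : ℕ) : IsLocalRing.ResidueField A) = 0 := by
    rw [← map_natCast (IsLocalRing.residue A), CharP.cast_eq_zero, map_zero]
  exact (CharP.charP_iff_prime_eq_zero Fact.out).2 h

/-- The degree `[L : L^p]` of a field `L` of characteristic `p`, with value `⊤` if it is
infinite. -/
def frobeniusDegree (p : ℕ) (L : Type*) [Field L] : ℕ∞ :=
  Cardinal.toENat (Module.rank (frobeniusSubfield p L) L)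

/-- The residue field `κ_ν` of the valuation ring of `ν`. -/
abbrev ResidueField (ν : Valuation K Γ₀) : Type _ :=
  IsLocalRing.ResidueField ν.valuationSubring

/-- The valuation `ν` of `K` is centered on the local ring `R` with fraction field `K`:
`R` is contained in the valuation ring `V` of `ν`, and the maximal ideal of `V` contracts to the
maximal ideal of `R`. -/
structure IsCenteredOn (ν : Valuation K Γ₀) (R : Type*) [CommRing R] [IsLocalRing R]
    [Algebra R K] [IsFractionRing R K] : Prop where
  le_valuationRing : ∀ r : R, algebraMap R K r ∈ ν.valuationSubring
  comap_maximalIdeal :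
    (IsLocalRing.maximalIdeal ν.valuationSubring).comap
      ((algebraMap R K).codRestrict ν.valuationSubring le_valuationRing) =
        IsLocalRing.maximalIdeal R

namespace IsCenteredOn

variable {ν : Valuation K Γ₀} {R : Type*} [CommRing R] [IsLocalRing R]
  [Algebra R K] [IsFractionRing R K]

/-- The inclusion of a center `R` into the valuation ring of `ν`. -/
def toValuationRing (h : IsCenteredOn ν R) : R →+* ν.valuationSubring :=
  (algebraMap R K).codRestrict ν.valuationSubring h.le_valuationRing

theorem isLocalHom (h : IsCenteredOn ν R) : IsLocalHom h.toValuationRing :=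
  ((IsLocalRing.local_hom_TFAE h.toValuationRing).out 0 4).2 h.comap_maximalIdeal

/-- The induced embedding `κ_R → κ_ν` of residue fields. -/
def residueFieldMap (h : IsCenteredOn ν R) : IsLocalRing.ResidueField R →+* ResidueField ν :=
  letI := h.isLocalHom
  IsLocalRing.ResidueField.map h.toValuationRing

/-- The transcendence degree of `κ_ν` over `κ_R`, with value `⊤` if it is infinite. -/
def residueTrdeg (h : IsCenteredOn ν R) : ℕ∞ :=
  letI : Algebra (IsLocalRing.ResidueField R) (ResidueField ν) := h.residueFieldMap.toAlgebra
  Cardinal.toENat (Algebra.trdeg (IsLocalRing.ResidueField R) (ResidueField ν))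

end IsCenteredOn

/-- `R` is an Abhyankar center of `ν`: the valuation `ν` is centered on `R`, and
`dim_ℚ (ℚ ⊗_ℤ Γ_ν) + tr.deg (κ_ν / κ_R) = dim R`. -/
def IsAbhyankarCenter (ν : Valuation K Γ₀) (R : Type*) [CommRing R] [IsLocalRing R]
    [Algebra R K] [IsFractionRing R K] : Prop :=
  ∃ h : IsCenteredOn ν R,
    ((rationalRank (ValueGroup ν) + h.residueTrdeg : ℕ∞) : WithBot ℕ∞) = ringKrullDim R

end AbhyankarCenter

end

/-!
The theorem has three ingredients.

*Abhyankar's inequality, with the case of equality.* Let `A` be a Noetherian domain contained in a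
valuation ring `V` of an extension field `L`, with `trdeg (L / A) ≤ s` and center of height `d`. If
`x₁, …, xᵣ` have rationally independent values and `y₁, …, yₜ` have residues that are algebraically
independent over `A`, then `r + t ≤ d + s`; if equality holds and `L` is finitely generated over
`A`, then the value group is finitely generated and the residue field is a finitely generated field
extension (`abhyankar`). The theorem uses the case where `A = R`, `L = K` and `s = 0`.

Values are written multiplicatively, so that the center consists of the elements of `A` of value
less than `1`. Let `f` be an element of the center of largest value; it exists since `A` is
Noetherian (`exists_maximal_center`). Suppose first that the powers of `f` have arbitrarily small
values. Then the inequality is obtained by counting. The monomials `x ^ α * y ^ β` of degree less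
than `n` in each variable, `n ^ (r + t)` in number, have linearly independent leading forms in the
graded ring of `V` (`leadIndep_mul_prod`). They lie in a power of `span {1, x, y}` which, up to a
common denominator, is contained in a submodule with `O(n ^ s)` generators
(`exists_pow_mul_mem_span_monomials`). The values of the generators, of the denominator and of the
monomials are comparable to powers of `v f` with exponents `O(n)`. Therefore the monomials remain
independent modulo the ideal generated by the `k`-th powers of a system of parameters of the
localization of `A` at the center, for a suitable `k` of order `n`; and a module with `m` generators
has length `O(m * n ^ d)` modulo this ideal (`LeadIndep.card_le`). So `n ^ (r + t)` is
`O(n ^ (s + d))`. If `r + t = s + d`, then multiplying the monomials by `N` further elements, such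
that the products still have independent leading forms, shows that `N` is bounded
(`exists_card_mul_pow_le`), and this gives both finiteness statements.

In general, let `V₁ ⊇ V` be the valuation ring obtained by inverting `f ≠ 0`. The valuation of `V`
is composed of that of `V₁`, whose center has smaller height, and of a valuation of the residue
field of `V₁`, to which the counting argument applies. Rational ranks and the residual transcendence
degrees add up accordingly, and induction on the height of the center concludes.

*Frobenius degrees.* For a field extension `L / k` of transcendence degree `t`, one has
`[L : L ^ p] ≤ p ^ t [k : k ^ p]`, with equality if `L / k` is finitely generated
(`frobeniusDegree_le_and_eq`): a finite extension does not change the degree, an algebraic one does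
not increase it, and for `k(y₁, …, yₜ)` a basis over the `p`-th powers can be written down.

*Index of `pΓ`.* A torsion-free group `Γ` of rank `r` has `[Γ : pΓ] ≤ p ^ r` (`mulIndex_le`), with
equality if `Γ` is finitely generated, hence free (`mulIndex_eq_of_finite`).

Consequently, with `r` the rational rank of `ν`, `t = trdeg (κ_ν / κ_R)` and `d = dim R`, the
product of `[Γ : pΓ]` and `[κ_ν : κ_ν ^ p]` is at most `p ^ (r + t) [κ_R : κ_R ^ p]`, where
`r + t ≤ d`. If it equals `p ^ d [κ_R : κ_R ^ p]`, then `r + t = d`; conversely, if `r + t = d`,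
then `Γ` and `κ_ν / κ_R` are finitely generated, and both estimates are equalities.
-/

open scoped Pointwise

noncomputable section

namespace AbhyankarCenter

/-! ### Lengths of modules -/

section Length

variable {B M : Type*} [CommRing B] [AddCommGroup M] [Module B M]

theorem length_add_one_le_of_lt {N N' : Submodule B M} (h : N < N') :
    Module.length B N + 1 ≤ Module.length B N' := by
  rw [Module.length_submodule, Module.length_submodule]
  exact Order.height_add_one_le h

theorem length_sup_le (N N' : Submodule B M) :
    Module.length B ↥(N ⊔ N') ≤ Module.length B N + Module.length B N' := by
  rw [← Module.length_prod]
  have hr : LinearMap.range (N.subtype.coprod N'.subtype) = N ⊔ N' := by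
    rw [LinearMap.range_coprod]; simp
  rw [← hr]
  exact Module.length_le_of_surjective _ (LinearMap.surjective_rangeRestrict _)

theorem length_span_singleton_le (J : Ideal B) (g : M) (hg : ∀ b ∈ J, b • g = 0) :
    Module.length B (Submodule.span B {g}) ≤ Module.length B (B ⧸ J) := by
  rw [← LinearMap.range_toSpanSingleton]
  refine Module.length_le_of_surjective
    (J.liftQ (LinearMap.toSpanSingleton B M g).rangeRestrict ?_) ?_
  · intro b hb
    rw [LinearMap.mem_ker]
    ext
    simpa using hg b hb
  · rw [← LinearMap.range_eq_top, Submodule.range_liftQ, LinearMap.range_rangeRestrict]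

theorem length_span_finset_le (J : Ideal B) (G : Finset M) (hg : ∀ g ∈ G, ∀ b ∈ J, b • g = 0) :
    Module.length B (Submodule.span B (G : Set M)) ≤ G.card * Module.length B (B ⧸ J) := by
  classical
  induction G using Finset.induction_on with
  | empty => rw [Finset.coe_empty, Submodule.span_empty]; simp
  | insert a s ha ih =>
    rw [Finset.coe_insert, Submodule.span_insert, Finset.card_insert_of_notMem ha]
    refine (length_sup_le _ _).trans ?_
    push_cast
    rw [add_mul, one_mul, add_comm]
    exact add_le_add (ih fun g h => hg g (Finset.mem_insert_of_mem h))
      (length_span_singleton_le J a (hg a (Finset.mem_insert_self a s)))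

theorem length_quotient_sup_span_mul_le (I : Ideal B) (x y : B) :
    Module.length B (B ⧸ (I ⊔ Ideal.span {x * y})) ≤
      Module.length B (B ⧸ (I ⊔ Ideal.span {x})) +
        Module.length B (B ⧸ (I ⊔ Ideal.span {y})) := by
  set Q := I ⊔ Ideal.span {x * y}
  have hle : Q ≤ I ⊔ Ideal.span {x} := by
    refine sup_le_sup_left ?_ _
    rw [Ideal.span_singleton_le_span_singleton]
    exact dvd_mul_right x y
  have hQx : Module.length B (B ⧸ Q) =
      Module.length B (Submodule.span B {Submodule.Quotient.mk (p := Q) x}) +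
      Module.length B ((B ⧸ Q) ⧸ Submodule.span B {Submodule.Quotient.mk (p := Q) x}) :=
    Module.length_eq_add_of_exact _ _ (Submodule.subtype_injective _) (Submodule.mkQ_surjective _)
      (LinearMap.exact_subtype_mkQ _)
  rw [hQx, add_comm]
  refine add_le_add ?_ ?_
  · refine Module.length_le_of_surjective (Submodule.liftQ _
      ((Submodule.mkQ (Submodule.span B {Submodule.Quotient.mk (p := Q) x})) ∘ₗ Q.mkQ) ?_) ?_
    · refine sup_le ?_ ?_
      · intro b hb
        have : (Submodule.Quotient.mk b : B ⧸ Q) = 0 :=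
          (Submodule.Quotient.mk_eq_zero _).2 (Ideal.mem_sup_left hb)
        rw [LinearMap.mem_ker, LinearMap.comp_apply]
        exact (congrArg _ this).trans (map_zero _)
      · rw [Ideal.span, Submodule.span_le, Set.singleton_subset_iff]
        simp only [SetLike.mem_coe, LinearMap.mem_ker, LinearMap.comp_apply, Submodule.mkQ_apply,
          Submodule.Quotient.mk_eq_zero]
        exact Submodule.mem_span_singleton_self _
    · rw [← LinearMap.range_eq_top, Submodule.range_liftQ, LinearMap.range_comp,
        Submodule.range_mkQ, Submodule.map_top, Submodule.range_mkQ]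
  · refine length_span_singleton_le _ _ ?_
    intro b hb
    rw [← Submodule.Quotient.mk_smul, Submodule.Quotient.mk_eq_zero, smul_eq_mul]
    obtain ⟨i, hi, z, hz, rfl⟩ := Submodule.mem_sup.1 hb
    obtain ⟨c, rfl⟩ := Ideal.mem_span_singleton'.1 hz
    rw [add_mul]
    refine Ideal.add_mem _ (Ideal.mem_sup_left (I.mul_mem_right _ hi)) (Ideal.mem_sup_right ?_)
    rw [Ideal.mem_span_singleton]
    exact ⟨c, by ring⟩

theorem length_quotient_sup_span_pow_le (I : Ideal B) (x : B) (n : ℕ) :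
    Module.length B (B ⧸ (I ⊔ Ideal.span {x ^ n})) ≤
      n * Module.length B (B ⧸ (I ⊔ Ideal.span {x})) := by
  induction n with
  | zero =>
    have : I ⊔ Ideal.span {x ^ 0} = ⊤ := by simp
    rw [this]
    simp
  | succ n ih =>
    rw [pow_succ]
    refine (length_quotient_sup_span_mul_le I _ _).trans ?_
    push_cast
    rw [add_mul, one_mul]
    exact add_le_add_left ih _

theorem length_quotient_span_pow_le {ι : Type*} (s : Finset ι) (x : ι → B) (k : ℕ) (I : Ideal B) :
    Module.length B (B ⧸ (I ⊔ Ideal.span ((fun i => x i ^ k) '' s))) ≤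
      k ^ s.card * Module.length B (B ⧸ (I ⊔ Ideal.span (x '' s))) := by
  classical
  induction s using Finset.induction_on generalizing I with
  | empty => rw [Finset.coe_empty, Set.image_empty, Set.image_empty]; simp
  | insert a s ha ih =>
    have e1 : ∀ y : ι → B, I ⊔ Ideal.span (y '' ↑(insert a s)) =
        (I ⊔ Ideal.span {y a}) ⊔ Ideal.span (y '' s) := by
      intro y
      rw [Finset.coe_insert, Set.image_insert_eq, Ideal.span_insert, sup_assoc]
    rw [e1, e1, Finset.card_insert_of_notMem ha, pow_succ, mul_assoc]
    refine (ih _).trans ?_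
    refine mul_le_mul_right ?_ _
    have e2 : ∀ b : B, (I ⊔ Ideal.span {b}) ⊔ Ideal.span (x '' s) =
        (I ⊔ Ideal.span (x '' s)) ⊔ Ideal.span {b} := fun b => sup_right_comm _ _ _
    rw [e2, e2]
    exact length_quotient_sup_span_pow_le _ _ _

end Length

/-! ### Families with independent leading forms -/

section LeadIndep

variable {L Γ₀ : Type*} [Field L] [LinearOrderedCommGroupWithZero Γ₀]

/-- The elements `e j` of `L` are nonzero, and those among them of any given value `γ` have
initial forms in `gr_γ` that are linearly independent over the image of `A` in the residue field:
a linear combination with coefficients in `A`, at least one of which has value `1`, again has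
value `γ`. -/
def LeadIndep (A : Type*) [CommRing A] [Algebra A L] (v : Valuation L Γ₀) {J : Type*}
    (e : J → L) : Prop :=
  (∀ j, e j ≠ 0) ∧ ∀ (S : Finset J) (c : J → A), ∀ j₀ ∈ S, v (algebraMap A L (c j₀)) = 1 →
    (∀ j ∈ S, v (e j) = v (e j₀)) → v (e j₀) ≤ v (∑ j ∈ S, c j • e j)

variable {A : Type*} [CommRing A] [Algebra A L] {v : Valuation L Γ₀}

theorem LeadIndep.comp {J J' : Type*} {e : J → L} (he : LeadIndep A v e) (f : J' → J)
    (hf : Function.Injective f) : LeadIndep A v (e ∘ f) := by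
  classical
  refine ⟨fun j => he.1 _, fun S c j₀ hj₀ h1 hS => ?_⟩
  have key := he.2 (S.image f) (Function.extend f c 0) (f j₀) (Finset.mem_image_of_mem f hj₀)
    (by rwa [hf.extend_apply]) ?_
  · rw [Finset.sum_image hf.injOn] at key
    simpa [hf.extend_apply] using key
  · intro j hj
    obtain ⟨i, hi, rfl⟩ := Finset.mem_image.1 hj
    exact hS i hi

/-- Independence over `A` passes to a localization of `A` at elements of value `1`. -/
theorem LeadIndep.localization {B : Type*} [CommRing B] [Algebra A B] [Algebra B L]
    [IsScalarTower A B L] (M : Submonoid A) [IsLocalization M B]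
    (hM : ∀ a ∈ M, v (algebraMap A L a) = 1)
    {J : Type*} {e : J → L} (he : LeadIndep A v e) : LeadIndep B v e := by
  refine ⟨he.1, fun S c j₀ hj₀ h1 hS => ?_⟩
  obtain ⟨b, hb⟩ := IsLocalization.exist_integer_multiples M S c
  choose! a ha using hb
  have hbv := hM b b.2
  have key := he.2 S a j₀ hj₀ ?_ hS
  · have : ∑ j ∈ S, a j • e j = algebraMap A L b * ∑ j ∈ S, c j • e j := by
      rw [Finset.mul_sum]
      refine Finset.sum_congr rfl fun j hj => ?_
      rw [← algebraMap_smul B (a j), ha j hj, smul_assoc, Algebra.smul_def]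
    rwa [this, map_mul, hbv, one_mul] at key
  · rw [IsScalarTower.algebraMap_apply A B L, ha j₀ hj₀, Algebra.smul_def, map_mul,
      ← IsScalarTower.algebraMap_apply A B L, map_mul, h1, hbv, one_mul]

/-- The elements of smaller value than every `e j` form a submodule. -/
def ltSubmodule (v : Valuation L Γ₀) (hA : ∀ a : A, v (algebraMap A L a) ≤ 1) {J : Type*}
    (e : J → L) (he : ∀ j, e j ≠ 0) : Submodule A L where
  carrier := {l | ∀ j, v l < v (e j)}
  zero_mem' j := by rw [map_zero]; exact zero_lt_iff.2 ((Valuation.ne_zero_iff v).2 (he j))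
  add_mem' ha hb j := lt_of_le_of_lt (v.map_add _ _) (max_lt (ha j) (hb j))
  smul_mem' c l hl j := by
    rw [Algebra.smul_def, map_mul]
    exact lt_of_le_of_lt (mul_le_of_le_one_left' (hA c)) (hl j)

/-- Adjoining the elements `e j` one by one, in the order of increasing value, gives strictly
increasing submodules, even modulo the elements of small value. -/
theorem LeadIndep.card_le_length {J : Type*} {e : J → L} (he : LeadIndep A v e)
    (hA : ∀ a : A, v (algebraMap A L a) ≤ 1) (S : Finset J) :
    (S.card : ℕ∞) ≤ Module.length A
      ((Submodule.span A (e '' S)).map (ltSubmodule v hA e he.1).mkQ) := by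
  classical
  set T := ltSubmodule v hA e he.1
  induction S using Finset.induction_on_max_value (fun j => v (e j)) with
  | empty => rw [Finset.coe_empty, Set.image_empty, Submodule.span_empty]; simp
  | insert a s ha hmax ih =>
    rw [Finset.card_insert_of_notMem ha]
    push_cast
    refine (add_le_add_left ih 1).trans (length_add_one_le_of_lt ?_)
    refine lt_of_le_of_ne (Submodule.map_mono (Submodule.span_mono
      (Set.image_mono (Finset.coe_subset.2 (Finset.subset_insert a s))))) fun heq => ?_
    have hmem : T.mkQ (e a) ∈ (Submodule.span A (e '' s)).map T.mkQ := by
      rw [heq]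
      exact Submodule.mem_map_of_mem (Submodule.subset_span ⟨a, by simp, rfl⟩)
    obtain ⟨w, hw, hwa⟩ := hmem
    have hsub : e a - w ∈ T := by
      rw [← Submodule.ker_mkQ T, LinearMap.mem_ker, map_sub, hwa, sub_self]
    obtain ⟨c, rfl⟩ := (Submodule.mem_span_image_finset_iff_exists_fun' A).1 hw
    -- Only the terms of the same value as `e a` matter: the others are of smaller value.
    set S' := s.filter fun j => v (e j) = v (e a)
    have hlt : v (e a - ∑ j ∈ S', c j • e j) < v (e a) := by
      have h1 : e a - ∑ j ∈ S', c j • e j = (e a - ∑ j ∈ s, c j • e j) +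
          ∑ j ∈ s.filter (fun j => ¬ v (e j) = v (e a)), c j • e j := by
        rw [← Finset.sum_filter_add_sum_filter_not s (fun j => v (e j) = v (e a))]
        ring
      rw [h1]
      refine v.map_add_lt (hsub a) (v.map_sum_lt ((Valuation.ne_zero_iff v).2 (he.1 a)) ?_)
      intro j hj
      rw [Finset.mem_filter] at hj
      rw [Algebra.smul_def, map_mul]
      exact lt_of_le_of_lt (mul_le_of_le_one_left' (hA _)) (lt_of_le_of_ne (hmax j hj.1) hj.2)
    have hnot : a ∉ S' := fun h => ha (Finset.mem_filter.1 h).1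
    have key := he.2 (insert a S') (fun j => if j = a then 1 else - c j) a
      (Finset.mem_insert_self _ _) (by simp) ?_
    · rw [Finset.sum_insert hnot] at key
      have : ∑ j ∈ S', (if j = a then 1 else - c j) • e j = - ∑ j ∈ S', c j • e j := by
        rw [← Finset.sum_neg_distrib]
        refine Finset.sum_congr rfl fun j hj => ?_
        rw [if_neg (by rintro rfl; exact hnot hj), neg_smul]
      rw [this, if_pos rfl, one_smul, ← sub_eq_add_neg] at key
      exact absurd key (not_le.2 hlt)
    · intro j hj
      rcases Finset.mem_insert.1 hj with rfl | hj
      · rfl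
      · exact (Finset.mem_filter.1 hj).2

/-- A family with independent leading forms inside the span of a finite set `G` is no larger than
the length of that span modulo elements of small value. The latter is bounded, since the `k`-th
powers of the `x i` carry `G` to elements of small value. -/
theorem LeadIndep.card_le {J ι : Type*} [Fintype J] [Fintype ι] {e : J → L}
    (he : LeadIndep A v e) (hA : ∀ a : A, v (algebraMap A L a) ≤ 1) (x : ι → A) (k : ℕ)
    (G : Finset L) (heG : ∀ j, e j ∈ Submodule.span A (G : Set L))
    (hG : ∀ g ∈ G, ∀ i j, v (algebraMap A L (x i) ^ k * g) < v (e j)) :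
    (Fintype.card J : ℕ∞) ≤
      G.card * (k ^ Fintype.card ι * Module.length A (A ⧸ Ideal.span (Set.range x))) := by
  classical
  set T := ltSubmodule v hA e he.1
  set I : Ideal A := Ideal.span ((fun i => x i ^ k) '' (Finset.univ : Finset ι))
  have h1 := he.card_le_length hA Finset.univ
  rw [Finset.card_univ] at h1
  have h2 : (Submodule.span A (e '' (Finset.univ : Finset J))).map T.mkQ ≤
      Submodule.span A ((G.image T.mkQ : Finset (L ⧸ T)) : Set (L ⧸ T)) := by
    rw [Finset.coe_image, ← Submodule.map_span]
    refine Submodule.map_mono (Submodule.span_le.2 ?_)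
    rintro _ ⟨j, -, rfl⟩
    exact heG j
  have h3 := Module.length_le_of_injective _ (Submodule.inclusion_injective h2)
  have h4 := length_span_finset_le I (G.image T.mkQ) ?_
  · have h5 := length_quotient_span_pow_le Finset.univ x k (⊥ : Ideal A)
    have e1 : ⊥ ⊔ Ideal.span ((fun i => x i ^ k) '' (Finset.univ : Finset ι)) = I := bot_sup_eq _
    have e2 : ⊥ ⊔ Ideal.span (x '' (Finset.univ : Finset ι)) = Ideal.span (Set.range x) := by
      rw [bot_sup_eq, Finset.coe_univ, Set.image_univ]
    rw [e1, e2, Finset.card_univ] at h5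
    refine h1.trans (h3.trans (h4.trans ?_))
    exact mul_le_mul' (Nat.cast_le.2 Finset.card_image_le) h5
  · intro q hq b hb
    obtain ⟨g, hg, rfl⟩ := Finset.mem_image.1 hq
    rw [← map_smul, ← LinearMap.mem_ker, Submodule.ker_mkQ]
    refine Submodule.span_induction (p := fun b _ => b • g ∈ T) ?_ ?_ ?_ ?_ hb
    · rintro _ ⟨i, -, rfl⟩ j
      simpa [Algebra.smul_def] using hG g hg i j
    · simp
    · intro a b _ _ ha hb
      rw [add_smul]; exact T.add_mem ha hb
    · intro a b _ hb
      rw [smul_assoc]; exact T.smul_mem _ hb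

end LeadIndep

/-! ### Growth of powers of finitely generated submodules of a field -/

section Growth

variable {A L : Type*} [CommRing A] [Field L] [Algebra A L]

theorem one_mem_span_insert (S : Set L) : (1 : L) ∈ Submodule.span A (insert 1 S) :=
  Submodule.subset_span (Set.mem_insert _ _)

theorem span_insert_pow_mono (S : Set L) {m n : ℕ} (h : m ≤ n) :
    Submodule.span A (insert 1 S) ^ m ≤ Submodule.span A (insert 1 S) ^ n :=
  pow_le_pow_right' (Submodule.one_le.2 (one_mem_span_insert S)) h

theorem exists_mem_span_pow_of_mem_adjoin (S : Set L) {w : L} (hw : w ∈ Algebra.adjoin A S) :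
    ∃ n, w ∈ Submodule.span A (insert 1 S) ^ n := by
  induction hw using Algebra.adjoin_induction with
  | mem x hx => exact ⟨1, by rw [pow_one]; exact Submodule.subset_span (Set.mem_insert_of_mem _ hx)⟩
  | algebraMap a =>
    refine ⟨0, ?_⟩
    rw [pow_zero]
    exact Submodule.algebraMap_mem a
  | add x y _ _ hx hy =>
    obtain ⟨m, hm⟩ := hx
    obtain ⟨n, hn⟩ := hy
    exact ⟨max m n, Submodule.add_mem _ (span_insert_pow_mono S (le_max_left _ _) hm)
      (span_insert_pow_mono S (le_max_right _ _) hn)⟩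
  | mul x y _ _ hx hy =>
    obtain ⟨m, hm⟩ := hx
    obtain ⟨n, hn⟩ := hy
    exact ⟨m + n, by rw [pow_add]; exact Submodule.mul_mem_mul hm hn⟩

/-- If `g` is integral over `A[S]`, then multiplication by `g` raises the degree in the elements
of `S` by a bounded amount, on a suitable finitely generated submodule. -/
theorem exists_span_mul_le_of_isIntegral (S : Set L) {g : L}
    (hg : IsIntegral (Algebra.adjoin A S) g) :
    ∃ (G : Finset L) (k : ℕ), (1 : L) ∈ G ∧
      ∀ w ∈ Submodule.span A (G : Set L), g * w ∈
        Submodule.span A (insert 1 S) ^ k * Submodule.span A (G : Set L) := by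
  classical
  set U := Submodule.span A (insert 1 S)
  obtain ⟨P, hP, hPg⟩ := hg
  have hc : ∀ i, ∃ n, (P.coeff i : L) ∈ U ^ n := fun i =>
    exists_mem_span_pow_of_mem_adjoin S (P.coeff i).2
  choose n hn using hc
  set k := (Finset.range (P.natDegree + 1)).sup n
  set G : Finset L := insert 1 ((Finset.range P.natDegree).image fun i => g ^ i)
  have hU1 : (1 : L) ∈ U ^ k := by
    have := span_insert_pow_mono (A := A) S (Nat.zero_le k)
    rw [pow_zero] at this
    exact this (Submodule.one_le.1 le_rfl)
  have hGmem : ∀ i < P.natDegree, g ^ i ∈ Submodule.span A (G : Set L) := fun i hi =>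
    Submodule.subset_span (Finset.mem_insert_of_mem
      (Finset.mem_image_of_mem _ (Finset.mem_range.2 hi)))
  have htop : g ^ P.natDegree ∈ U ^ k * Submodule.span A (G : Set L) := by
    have h0 : g ^ P.natDegree = - ∑ i ∈ Finset.range P.natDegree, (P.coeff i : L) * g ^ i := by
      rw [Polynomial.eval₂_eq_sum_range, Finset.sum_range_succ, hP.coeff_natDegree, map_one,
        one_mul] at hPg
      exact eq_neg_of_add_eq_zero_right hPg
    rw [h0]
    refine Submodule.neg_mem _ (Submodule.sum_mem _ fun i hi => Submodule.mul_mem_mul ?_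
      (hGmem i (Finset.mem_range.1 hi)))
    exact span_insert_pow_mono S (Finset.le_sup (Finset.mem_range.2
      ((Finset.mem_range.1 hi).trans (Nat.lt_succ_self _)))) (hn i)
  have hlow : ∀ i ≤ P.natDegree, g ^ i ∈ U ^ k * Submodule.span A (G : Set L) := by
    intro i hi
    rcases hi.lt_or_eq with h | rfl
    · simpa using Submodule.mul_mem_mul hU1 (hGmem i h)
    · exact htop
  refine ⟨G, k, Finset.mem_insert_self _ _, fun w hw => ?_⟩
  induction hw using Submodule.span_induction with
  | mem w hw =>
    rcases Finset.mem_insert.1 hw with rfl | hw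
    · rcases Nat.eq_zero_or_pos P.natDegree with h | h
      · -- a monic polynomial of degree `0` has no root
        have : P = 1 := hP.natDegree_eq_zero.1 h
        simp [this] at hPg
      · simpa using hlow 1 h
    · obtain ⟨i, hi, rfl⟩ := Finset.mem_image.1 hw
      rw [← pow_succ']
      exact hlow _ (Finset.mem_range.1 hi)
  | zero => rw [mul_zero]; exact Submodule.zero_mem _
  | add x y _ _ hx hy => rw [mul_add]; exact Submodule.add_mem _ hx hy
  | smul a x _ hx => rw [mul_smul_comm]; exact Submodule.smul_mem _ a hx

/-- The monomials of degree at most `m` in the elements `u i`. -/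
def monomials [DecidableEq L] {σ : Type*} [Fintype σ] [DecidableEq σ] (u : σ → L) (m : ℕ) :
    Finset L :=
  ((Fintype.piFinset fun _ : σ => Finset.range (m + 1)).filter fun δ => ∑ i, δ i ≤ m).image
    fun δ => ∏ i, u i ^ δ i

variable [DecidableEq L] {σ : Type*} [Fintype σ] [DecidableEq σ] (u : σ → L)

theorem card_monomials_le (m : ℕ) : (monomials u m).card ≤ (m + 1) ^ Fintype.card σ := by
  refine Finset.card_image_le.trans ((Finset.card_filter_le _ _).trans ?_)
  simp

theorem mem_monomials {m : ℕ} {w : L} :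
    w ∈ monomials u m ↔ ∃ δ : σ → ℕ, ∑ i, δ i ≤ m ∧ ∏ i, u i ^ δ i = w := by
  simp only [monomials, Finset.mem_image, Finset.mem_filter, Fintype.mem_piFinset,
    Finset.mem_range, Nat.lt_succ_iff]
  constructor
  · rintro ⟨δ, ⟨-, h⟩, rfl⟩
    exact ⟨δ, h, rfl⟩
  · rintro ⟨δ, h, rfl⟩
    exact ⟨δ, ⟨fun i => (Finset.single_le_sum (fun _ _ => Nat.zero_le _)
      (Finset.mem_univ i)).trans h, h⟩, rfl⟩

theorem span_pow_le_span_monomials (m : ℕ) :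
    Submodule.span A (insert 1 (Set.range u)) ^ m ≤
      Submodule.span A (monomials u m : Set L) := by
  induction m with
  | zero =>
    rw [pow_zero, Submodule.one_eq_span, Submodule.span_le, Set.singleton_subset_iff]
    exact Submodule.subset_span ((mem_monomials u).2 ⟨0, by simp, by simp⟩)
  | succ m ih =>
    rw [pow_succ]
    refine (mul_le_mul_left ih _).trans ?_
    rw [Submodule.span_mul_span, Submodule.span_le]
    rintro _ ⟨w, hw, z, hz, rfl⟩
    obtain ⟨δ, hδ, rfl⟩ := (mem_monomials u).1 hw
    refine Submodule.subset_span ((mem_monomials u).2 ?_)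
    rcases hz with rfl | ⟨i, rfl⟩
    · exact ⟨δ, hδ.trans m.le_succ, by simp⟩
    · refine ⟨δ + Pi.single i 1, ?_, ?_⟩
      · simp only [Pi.add_apply, Finset.sum_add_distrib, Finset.sum_pi_single', Finset.mem_univ,
          if_true]
        omega
      · simp only [Pi.add_apply, pow_add, Finset.prod_mul_distrib]
        congr 1
        rw [Finset.prod_eq_single i]
        · simp
        · intro j _ hj
          simp [Pi.single_eq_of_ne hj]
        · simp

theorem exists_span_mul_le_of_forall_isIntegral (S : Set L) (F : Finset L)
    (hF : ∀ g ∈ F, IsIntegral (Algebra.adjoin A S) g) :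
    ∃ (G : Finset L) (k : ℕ), (1 : L) ∈ G ∧
      Submodule.span A (F : Set L) * Submodule.span A (G : Set L) ≤
        Submodule.span A (insert 1 S) ^ k * Submodule.span A (G : Set L) := by
  induction F using Finset.induction_on with
  | empty => exact ⟨{1}, 0, by simp, by simp⟩
  | insert a F _ ih =>
    obtain ⟨G, k, h1, h⟩ := ih fun g hg => hF g (Finset.mem_insert_of_mem hg)
    obtain ⟨G', k', h1', h'⟩ := exists_span_mul_le_of_isIntegral S
      (hF a (Finset.mem_insert_self _ _))
    set U := Submodule.span A (insert 1 S)
    refine ⟨G * G', k + k', ?_, ?_⟩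
    · simpa using Finset.mul_mem_mul h1 h1'
    · rw [Finset.coe_mul, ← Submodule.span_mul_span, Finset.coe_insert, Submodule.span_insert,
        Submodule.sup_mul]
      have hmono : ∀ {i j : ℕ}, i ≤ j → U ^ i ≤ U ^ j := fun h => span_insert_pow_mono S h
      refine sup_le ?_ ?_
      · have : Submodule.span A {a} * Submodule.span A (G' : Set L) ≤
            U ^ k' * Submodule.span A (G' : Set L) := by
          rw [Submodule.mul_le]
          intro m hm w hw
          obtain ⟨c, rfl⟩ := Submodule.mem_span_singleton.1 hm
          rw [smul_mul_assoc]
          exact Submodule.smul_mem _ c (h' w hw)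
        rw [mul_left_comm]
        refine (mul_le_mul_right this _).trans ?_
        rw [mul_left_comm]
        exact mul_le_mul_left (hmono (Nat.le_add_left _ _)) _
      · rw [← mul_assoc]
        refine (mul_le_mul_left h _).trans ?_
        rw [mul_assoc]
        exact mul_le_mul_left (hmono (Nat.le_add_right _ _)) _

/-- In a field `L` of transcendence degree at most `s` over `A`, the powers of a finitely generated
submodule grow polynomially of degree `s`, up to a denominator that grows like a power. -/
theorem exists_pow_mul_mem_span_monomials [IsDomain A] [FaithfulSMul A L] (s : ℕ)
    (hs : Algebra.trdeg A L ≤ s) (F : Finset L) :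
    ∃ (b : L) (σ : Finset L) (k : ℕ) (G : Finset L), b ≠ 0 ∧ σ.card ≤ s ∧
      ∀ (n : ℕ), ∀ w ∈ Submodule.span A (insert 1 (F : Set L)) ^ n,
        b ^ n * w ∈ Submodule.span A
          ((monomials (fun i : σ => (i : L)) (k * n) * G : Finset L) : Set L) := by
  obtain ⟨σ, hσ⟩ := exists_isTranscendenceBasis A L
  have hcard := hσ.cardinalMk_eq_trdeg
  have hfin : σ.Finite := by
    rw [← Set.finite_coe_iff, ← Cardinal.lt_aleph0_iff_finite, hcard]
    exact hs.trans_lt (Cardinal.natCast_lt_aleph0)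
  lift σ to Finset L using hfin
  have hσs : σ.card ≤ s := by
    rw [← hcard] at hs
    simpa using hs
  have halg : ∀ w : L, IsAlgebraic (Algebra.adjoin A (σ : Set L)) w := by
    have := hσ.isAlgebraic
    rw [Subtype.range_coe] at this
    exact this.isAlgebraic
  have : Algebra.IsAlgebraic (Algebra.adjoin A (σ : Set L)) L := ⟨halg⟩
  obtain ⟨b, hb, hbF⟩ := Algebra.IsAlgebraic.exists_integral_multiples
    (Algebra.adjoin A (σ : Set L)) F
  obtain ⟨G, k, h1, hG⟩ := exists_span_mul_le_of_forall_isIntegral (A := A) (σ : Set L)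
    (insert (b : L) (F.image fun w => (b : L) * w)) (by
      intro g hg
      rcases Finset.mem_insert.1 hg with rfl | hg
      · exact isIntegral_algebraMap (x := b)
      · obtain ⟨w, hw, rfl⟩ := Finset.mem_image.1 hg
        exact hbF w hw)
  refine ⟨b, σ, k, G, by simpa using hb, hσs, fun n w hw => ?_⟩
  set M := Submodule.span A ((insert (b : L) (F.image fun w => (b : L) * w) : Finset L) : Set L)
  set U := Submodule.span A (insert 1 (σ : Set L))
  have hMn : ∀ n, M ^ n * Submodule.span A (G : Set L) ≤
      U ^ (k * n) * Submodule.span A (G : Set L) := by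
    intro n
    induction n with
    | zero => simp
    | succ n ih =>
      rw [pow_succ, mul_assoc]
      refine (mul_le_mul_right hG _).trans ?_
      rw [mul_left_comm]
      refine (mul_le_mul_right ih _).trans ?_
      rw [← mul_assoc, ← pow_add, mul_add, mul_one, add_comm]
  have hbw : ∀ n, ∀ w ∈ Submodule.span A (insert 1 (F : Set L)) ^ n, (b : L) ^ n * w ∈ M ^ n := by
    have hb1 : Submodule.span A {(b : L)} * Submodule.span A (insert 1 (F : Set L)) ≤ M := by
      rw [Submodule.span_mul_span, Submodule.span_le]
      rintro _ ⟨x, rfl, y, hy, rfl⟩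
      refine Submodule.subset_span ?_
      rcases hy with rfl | hy
      · simp
      · exact Finset.mem_coe.2 (Finset.mem_insert_of_mem (Finset.mem_image_of_mem _ hy))
    intro n w hw
    have := Submodule.mul_mem_mul (Submodule.pow_mem_pow _
      (Submodule.mem_span_singleton_self (R := A) (b : L)) n) hw
    rw [← mul_pow] at this
    exact pow_le_pow_left' hb1 n this
  have h2 : (b : L) ^ n * w ∈ U ^ (k * n) * Submodule.span A (G : Set L) := by
    refine hMn n ?_
    simpa using Submodule.mul_mem_mul (hbw n w hw) (Submodule.subset_span h1)
  rw [Finset.coe_mul, ← Submodule.span_mul_span]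
  have h3 := span_pow_le_span_monomials (A := A) (fun i : σ => (i : L)) (k * n)
  rw [show Set.range (fun i : σ => (i : L)) = σ by simp] at h3
  exact (mul_le_mul_left h3 _ : U ^ (k * n) * Submodule.span A (G : Set L) ≤ _) h2

end Growth

/-! ### The counting argument -/

section Counting

variable {A L Γ₀ : Type*} [CommRing A] [Field L] [Algebra A L]
  [LinearOrderedCommGroupWithZero Γ₀] {v : Valuation L Γ₀}

theorem LeadIndep.const_mul {J : Type*} {e : J → L} (he : LeadIndep A v e) {b : L} (hb : b ≠ 0) :
    LeadIndep A v fun j => b * e j := by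
  refine ⟨fun j => mul_ne_zero hb (he.1 j), fun S c j₀ hj₀ h1 hS => ?_⟩
  have hvb : v b ≠ 0 := (Valuation.ne_zero_iff v).2 hb
  have key := he.2 S c j₀ hj₀ h1 fun j hj => by
    have := hS j hj
    rw [map_mul, map_mul] at this
    exact mul_left_cancel₀ hvb this
  have e1 : ∑ j ∈ S, c j • (b * e j) = b * ∑ j ∈ S, c j • e j := by
    rw [Finset.mul_sum]
    exact Finset.sum_congr rfl fun j _ => (mul_smul_comm _ _ _).symm
  rw [e1, map_mul, map_mul]
  exact mul_le_mul_right key _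

/-- The center on `A` of a valuation that is nonnegative on `A`: the prime ideal of the elements of
positive (in multiplicative notation: smaller than `1`) value. -/
def centerIdeal (v : Valuation L Γ₀) (hA : ∀ a : A, v (algebraMap A L a) ≤ 1) : Ideal A where
  carrier := {a | v (algebraMap A L a) < 1}
  zero_mem' := by simp
  add_mem' {a b} ha hb := by
    change v (algebraMap A L (a + b)) < 1
    rw [map_add]
    exact v.map_add_lt ha hb
  smul_mem' c a ha := by
    change v (algebraMap A L (c * a)) < 1
    rw [map_mul, map_mul]
    exact lt_of_le_of_lt (mul_le_of_le_one_left' (hA c)) ha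

theorem mem_centerIdeal {hA : ∀ a : A, v (algebraMap A L a) ≤ 1} {a : A} :
    a ∈ centerIdeal v hA ↔ v (algebraMap A L a) < 1 := Iff.rfl

theorem notMem_centerIdeal {hA : ∀ a : A, v (algebraMap A L a) ≤ 1} {a : A} :
    a ∉ centerIdeal v hA ↔ v (algebraMap A L a) = 1 := by
  rw [mem_centerIdeal, not_lt]
  exact ⟨fun h => le_antisymm (hA a) h, fun h => h.ge⟩

instance (hA : ∀ a : A, v (algebraMap A L a) ≤ 1) : (centerIdeal v hA).IsPrime := by
  refine Ideal.isPrime_iff.2 ⟨?_, ?_⟩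
  · rw [Ne, Ideal.eq_top_iff_one, mem_centerIdeal]
    simp
  · intro a b hab
    by_contra! h
    rw [notMem_centerIdeal, notMem_centerIdeal] at h
    rw [mem_centerIdeal, map_mul, map_mul, h.1, h.2] at hab
    simp at hab

theorem prod_pow_mem_pow {ι : Type*} (M : Submodule A L) (S : Finset ι) (x : ι → L)
    (hx : ∀ i ∈ S, x i ∈ M) (α : ι → ℕ) : ∏ i ∈ S, x i ^ α i ∈ M ^ ∑ i ∈ S, α i := by
  classical
  induction S using Finset.induction_on with
  | empty => simp [Submodule.one_le.1 le_rfl]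
  | insert a S ha ih =>
    rw [Finset.prod_insert ha, Finset.sum_insert ha, pow_add]
    exact Submodule.mul_mem_mul (Submodule.pow_mem_pow _ (hx a (Finset.mem_insert_self _ _)) _)
      (ih fun i hi => hx i (Finset.mem_insert_of_mem hi))

theorem pow_mul_prod_le_one {ι : Type*} (S : Finset ι) {φ : Γ₀} (hφ : φ ≤ 1) (k : ℕ) (w : ι → Γ₀)
    (hw : ∀ i ∈ S, φ ^ k * w i ≤ 1) (δ : ι → ℕ) (m : ℕ) (hδ : ∑ i ∈ S, δ i ≤ m) :
    φ ^ (k * m) * ∏ i ∈ S, w i ^ δ i ≤ 1 := by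
  have h1 : φ ^ (k * ∑ i ∈ S, δ i) * ∏ i ∈ S, w i ^ δ i = ∏ i ∈ S, (φ ^ k * w i) ^ δ i := by
    simp only [mul_pow, Finset.prod_mul_distrib, Finset.mul_sum, ← pow_mul,
      Finset.prod_pow_eq_pow_sum]
  refine le_trans (mul_le_mul_left (pow_le_pow_right_of_le_one' hφ (Nat.mul_le_mul_left k hδ)) _) ?_
  rw [h1]
  exact Finset.prod_le_one' fun i hi => pow_le_one' (hw i hi) _

/-- Finitely many elements are brought below `1` by one power of `f`, if each of them is. -/
theorem exists_pow_mul_lt_one {f : A} (hf : v (algebraMap A L f) < 1)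
    (hcof : ∀ l : L, ∃ k, v (algebraMap A L f ^ k * l) < 1) (S : Finset L) :
    ∃ k, ∀ l ∈ S, v (algebraMap A L f) ^ k * v l < 1 := by
  classical
  choose k hk using hcof
  refine ⟨S.sup k, fun l hl => lt_of_le_of_lt ?_ (hk l)⟩
  rw [map_mul, map_pow]
  exact mul_le_mul_left (pow_le_pow_right_of_le_one' hf.le (Finset.le_sup hl)) _

/-- The number of elements with independent leading forms in the `n`-th step of a filtration of `L`
is at most of the order `n ^ (s + d)`, where `s` is the transcendence degree of `L` and `d` is the
height of the center. It is assumed that the multiples of the least positive value `v f` on `A` are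
cofinal in the value group. The constant `C` does not depend on the family `z`. -/
theorem exists_card_mul_pow_le [IsDomain A] [IsNoetherianRing A] [FaithfulSMul A L]
    (hA : ∀ a : A, v (algebraMap A L a) ≤ 1) {s d : ℕ} (hs : Algebra.trdeg A L ≤ s)
    (hd : (centerIdeal v hA).height = d) {f : A} (hf : v (algebraMap A L f) < 1)
    (hfmax : ∀ a ∈ centerIdeal v hA, v (algebraMap A L a) ≤ v (algebraMap A L f))
    (hcof : ∀ l : L, ∃ k, v (algebraMap A L f ^ k * l) < 1) (F : Finset L)
    {ι : Type*} [Fintype ι] {x : ι → L} (hxF : ∀ i, x i ∈ F) :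
    ∃ C : ℕ, ∀ (N : ℕ) (z : Fin N → L) (h : L), h ≠ 0 →
      (∀ i, h * z i ∈ Algebra.adjoin A (F : Set L)) →
      LeadIndep A v (fun q : Fin N × (ι → ℕ) => z q.1 * ∏ i, x i ^ q.2 i) →
      ∃ n₀, ∀ n ≥ n₀, N * n ^ Fintype.card ι ≤ C * n ^ (s + d) := by
  classical
  obtain ⟨b, σ, k, G, hb, hσ, hG⟩ := exists_pow_mul_mem_span_monomials s hs F
  set p := centerIdeal v hA
  let B := Localization.AtPrime p
  have hunit : ∀ a : p.primeCompl, IsUnit (algebraMap A L a) := fun a => by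
    refine IsUnit.mk0 _ fun h0 => a.2 ?_
    rw [SetLike.mem_coe, mem_centerIdeal, h0, map_zero]
    exact zero_lt_one
  let _ : Algebra B L := (IsLocalization.lift (M := p.primeCompl) (S := B) hunit).toAlgebra
  have hmap : ∀ a, algebraMap B L (algebraMap A B a) = algebraMap A L a :=
    fun a => IsLocalization.lift_eq hunit a
  have : IsScalarTower A B L := IsScalarTower.of_algebraMap_eq fun a => (hmap a).symm
  have hBmk : ∀ b : B, ∃ a : A, v (algebraMap B L b) = v (algebraMap A L a) := by
    intro b
    obtain ⟨⟨a, c⟩, hac⟩ := IsLocalization.surj p.primeCompl b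
    refine ⟨a, ?_⟩
    have hc : v (algebraMap A L c) = 1 := notMem_centerIdeal.1 c.2
    rw [← hmap, ← hac, map_mul, map_mul, hmap, hc, mul_one]
  have hB : ∀ b : B, v (algebraMap B L b) ≤ 1 := fun b => by
    obtain ⟨a, ha⟩ := hBmk b
    exact ha ▸ hA a
  have hBm : ∀ b ∈ IsLocalRing.maximalIdeal B, v (algebraMap B L b) ≤ v (algebraMap A L f) := by
    intro b hb
    obtain ⟨⟨a, c⟩, hac⟩ := IsLocalization.surj p.primeCompl b
    have hc : v (algebraMap A L c) = 1 := notMem_centerIdeal.1 c.2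
    have hap : a ∈ p := by
      rw [← IsLocalization.AtPrime.to_map_mem_maximal_iff B p a, ← hac]
      exact Ideal.mul_mem_right _ _ hb
    have : v (algebraMap B L b) = v (algebraMap A L a) := by
      rw [← hmap, ← hac, map_mul, map_mul, hmap, hc, mul_one]
    exact this ▸ hfmax a hap
  -- a system of parameters of the localization at the center
  obtain ⟨q, hq, hqd⟩ :=
    (IsLocalRing.maximalIdeal B).exists_finset_card_eq_height_of_isNoetherianRing
  have hqd : q.card = d := by
    have h1 : ((IsLocalRing.maximalIdeal B).height : WithBot ℕ∞) = p.height := by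
      rw [IsLocalRing.maximalIdeal_height_eq_ringKrullDim,
        IsLocalization.AtPrime.ringKrullDim_eq_height p B]
    rw [WithBot.coe_inj.1 h1, hd] at hqd
    exact_mod_cast hqd
  have hqm : ∀ w ∈ q, w ∈ IsLocalRing.maximalIdeal B := fun w hw =>
    hq.1.2 (Ideal.subset_span hw)
  have hart : IsArtinianRing (B ⧸ Ideal.span (q : Set B)) :=
    IsLocalRing.quotient_artinian_of_mem_minimalPrimes_of_isLocalRing _ hq
  have hlen : Module.length B (B ⧸ Ideal.span (q : Set B)) ≠ ⊤ := by
    rw [Module.length_eq_of_surjective (S := B) (R := B ⧸ Ideal.span (q : Set B))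
      Ideal.Quotient.mk_surjective]
    exact Module.length_ne_top
  obtain ⟨len, hlen⟩ := ENat.ne_top_iff_exists.1 hlen
  set φ := v (algebraMap A L f)
  obtain ⟨κ, hκ⟩ := exists_pow_mul_lt_one hf hcof
    (insert b⁻¹ (σ ∪ Finset.univ.image fun i => (x i)⁻¹))
  set c := Fintype.card ι
  set D := κ * (k * (c + 1)) + κ * (c + 1) + κ * c + 3
  refine ⟨(k * (c + 1) + 1) ^ s * G.card * (D ^ d * len), fun N z h hh hz hind => ?_⟩
  obtain ⟨κ', hκ'⟩ := exists_pow_mul_lt_one hf hcof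
    (insert h⁻¹ (G ∪ Finset.univ.image fun i => (z i)⁻¹))
  have hzdeg : ∃ K', ∀ i, h * z i ∈ Submodule.span A (insert 1 (F : Set L)) ^ K' := by
    choose K hK using fun i => exists_mem_span_pow_of_mem_adjoin _ (hz i)
    exact ⟨Finset.univ.sup K, fun i => span_insert_pow_mono _ (Finset.le_sup (Finset.mem_univ i))
      (hK i)⟩
  obtain ⟨K', hK'⟩ := hzdeg
  refine ⟨K' + κ' + 1, fun n hn => ?_⟩
  -- The elements to be counted are multiplied by `b ^ m * h`, so that they lie in the span of
  -- `monomials (k * m) * G`. The exponent `E` makes `φ ^ E` small enough to bring these generators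
  -- below all elements of the family: the summands account for the monomials in `σ`, for `b ^ m`,
  -- for the monomials in the `x i`, and for the elements `h`, `z i` and those of `G`.
  set m := K' + c * n
  set E := κ * (k * m) + κ * m + κ * (c * n) + (κ' + κ' + κ')
  have hm : m ≤ (c + 1) * n := by
    simp only [m]; nlinarith
  have hE : E ≤ D * n := by
    have h1 : κ * (k * m) ≤ κ * (k * ((c + 1) * n)) := by gcongr
    have h2 : κ * m ≤ κ * ((c + 1) * n) := by gcongr
    have h3 : κ' ≤ n := by omega
    simp only [E, D]
    linarith
  have hsum : ∀ α : ι → Fin n, ∑ i, (α i : ℕ) ≤ c * n := fun α => by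
    refine (Finset.sum_le_card_nsmul _ _ n fun i _ => (α i).2.le).trans ?_
    simp [c]
  -- the family to be counted
  set e : Fin N × (ι → Fin n) → L := fun q => (b ^ m * h) * (z q.1 * ∏ i, x i ^ (q.2 i : ℕ))
  have he : LeadIndep B v e := by
    refine LeadIndep.localization (A := A) p.primeCompl (fun a ha => notMem_centerIdeal.1 ha) ?_
    exact (hind.comp (fun q : Fin N × (ι → Fin n) => (q.1, fun i => (q.2 i : ℕ))) (by
      rintro ⟨i, α⟩ ⟨j, β⟩ hij
      simp only [Prod.mk.injEq] at hij
      refine Prod.ext hij.1 (funext fun i => Fin.ext (congrFun hij.2 i)))).const_mul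
        (mul_ne_zero (pow_ne_zero _ hb) hh)
  set Gm := monomials (fun i : σ => (i : L)) (k * m) * G
  have heG : ∀ j, e j ∈ Submodule.span B (Gm : Set L) := by
    rintro ⟨i, α⟩
    refine Submodule.span_subset_span A B _ ?_
    have h1 : ∏ i, x i ^ (α i : ℕ) ∈ Submodule.span A (insert 1 (F : Set L)) ^ (c * n) := by
      refine span_insert_pow_mono _ (hsum α) ?_
      exact prod_pow_mem_pow _ _ _
        (fun i _ => Submodule.subset_span (Set.mem_insert_of_mem _ (hxF i))) _
    have h2 := hG m ((h * z i) * ∏ i, x i ^ (α i : ℕ)) (by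
      rw [pow_add]
      exact Submodule.mul_mem_mul (hK' i) h1)
    have h3 : e (i, α) = b ^ m * ((h * z i) * ∏ i, x i ^ (α i : ℕ)) := by simp only [e]; ring
    rw [h3]
    exact h2
  have hφ1 : φ ≤ 1 := hf.le
  have hsmall : ∀ g ∈ Gm, ∀ (w : q) (j), v (algebraMap B L (w : B) ^ E * g) < v (e j) := by
    rintro g hg w ⟨i, α⟩
    obtain ⟨u, hu, g, hg', rfl⟩ := Finset.mem_mul.1 hg
    obtain ⟨δ, hδ, rfl⟩ := (mem_monomials _).1 hu
    have hej := he.1 (i, α)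
    have hz0 : z i ≠ 0 := fun h0 => hej (by simp [e, h0])
    have hx0 : ∏ i, x i ^ (α i : ℕ) ≠ 0 := fun h0 => hej (by simp only [e, h0, mul_zero])
    have t1 : φ ^ (κ * (k * m)) * ∏ i : σ, v (i : L) ^ δ i ≤ 1 :=
      pow_mul_prod_le_one _ hφ1 κ (fun i : σ => v (i : L)) (fun i _ => (hκ i (by simp)).le) δ _ hδ
    have t2 : φ ^ κ' * v g < 1 := hκ' g (by simp [hg'])
    have t3 : (φ ^ κ * v b⁻¹) ^ m ≤ 1 := pow_le_one' (hκ _ (by simp)).le _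
    have t4 : φ ^ κ' * v h⁻¹ ≤ 1 := (hκ' _ (by simp)).le
    have t5 : φ ^ κ' * v (z i)⁻¹ ≤ 1 := (hκ' _ (by simp)).le
    have t6 : φ ^ (κ * (c * n)) * ∏ i, v (x i)⁻¹ ^ (α i : ℕ) ≤ 1 :=
      pow_mul_prod_le_one _ hφ1 κ _ (fun i _ => (hκ _ (by simp)).le) (fun i => (α i : ℕ)) _ (hsum α)
    have hprod : φ ^ E * v ((∏ i : σ, (i : L) ^ δ i) * g) * (v (e (i, α)))⁻¹ < 1 := by
      have : φ ^ E * v ((∏ i : σ, (i : L) ^ δ i) * g) * (v (e (i, α)))⁻¹ =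
          (φ ^ (κ * (k * m)) * ∏ i : σ, v (i : L) ^ δ i) * (φ ^ κ * v b⁻¹) ^ m *
          (φ ^ κ' * v h⁻¹) * (φ ^ κ' * v (z i)⁻¹) *
          (φ ^ (κ * (c * n)) * ∏ i, v (x i)⁻¹ ^ (α i : ℕ)) * (φ ^ κ' * v g) := by
        simp only [e, E, map_mul, map_prod, map_pow, map_inv₀, mul_inv, pow_add, ← pow_mul, mul_pow,
          inv_pow, Finset.prod_inv_distrib]
        ac_rfl
      rw [this]
      exact lt_of_le_of_lt (mul_le_of_le_one_left'
        (mul_le_one' (mul_le_one' (mul_le_one' (mul_le_one' t1 t3) t4) t5) t6)) t2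
    have hve : 0 < v (e (i, α)) := zero_lt_iff.2 ((Valuation.ne_zero_iff v).2 hej)
    rw [map_mul, map_pow]
    refine lt_of_le_of_lt (mul_le_mul_left (pow_le_pow_left' (hBm _ (hqm _ w.2)) E) _) ?_
    rwa [← div_eq_mul_inv, div_lt_one₀ hve] at hprod
  have hcount := he.card_le hB (fun w : q => (w : B)) E Gm heG hsmall
  have hGm : Gm.card ≤ (k * (c + 1) + 1) ^ s * n ^ s * G.card := by
    refine Finset.card_mul_le.trans ?_
    refine Nat.mul_le_mul_right _ ((card_monomials_le _ _).trans ?_)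
    rw [Fintype.card_coe, ← mul_pow]
    have h1 : k * m + 1 ≤ (k * (c + 1) + 1) * n := by
      have : k * m ≤ k * ((c + 1) * n) := by gcongr
      nlinarith
    exact (Nat.pow_le_pow_left h1 _).trans
      (Nat.pow_le_pow_right (lt_of_lt_of_le (Nat.succ_pos _) h1) hσ)
  rw [show Set.range (fun w : q => (w : B)) = q by simp, ← hlen, Fintype.card_coe, hqd,
    Fintype.card_prod, Fintype.card_pi] at hcount
  simp only [Fintype.card_fin, Finset.prod_const, Finset.card_univ] at hcount
  have hcount' : N * n ^ c ≤ Gm.card * (E ^ d * len) := by exact_mod_cast hcount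
  refine hcount'.trans ((Nat.mul_le_mul hGm (Nat.mul_le_mul_right len
    (Nat.pow_le_pow_left hE d))).trans (le_of_eq ?_))
  rw [mul_pow]
  ring

end Counting

/-! ### Independent values and residues, and what the counting argument says about them -/

section Indep

variable {A L Γ₀ : Type*} [CommRing A] [Field L] [Algebra A L]
  [LinearOrderedCommGroupWithZero Γ₀]

/-- The values of the nonzero elements `x i` are rationally independent. -/
def RatIndep (v : Valuation L Γ₀) {ι : Type*} [Fintype ι] (x : ι → L) : Prop :=
  (∀ i, x i ≠ 0) ∧ ∀ e : ι → ℤ, v (∏ i, x i ^ e i) = 1 → e = 0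

/-- The elements `y i` of the valuation ring have residues that are algebraically independent over
the image of `A` in the residue field. This is expressed by polynomials with coefficients in `A`, to
avoid mentioning the residue field. -/
def ResIndep (A : Type*) [CommRing A] [Algebra A L] (v : Valuation L Γ₀) {ι : Type*}
    (y : ι → L) : Prop :=
  (∀ i, v (y i) ≤ 1) ∧ ∀ P : MvPolynomial ι A, v (MvPolynomial.aeval y P) < 1 →
    ∀ m, v (algebraMap A L (P.coeff m)) < 1

/-- The value group is finitely generated. -/
def ValFG (v : Valuation L Γ₀) : Prop :=
  ∃ S : Set Lˣ, S.Finite ∧ ∀ l : Lˣ, ∃ g ∈ Subgroup.closure S, v l = v g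

/-- The residue field is finitely generated, as a field, over the image of `A`. -/
def ResFG (A : Type*) [CommRing A] [Algebra A L] (v : Valuation L Γ₀) : Prop :=
  ∃ F : Finset L, (∀ w ∈ F, v w ≤ 1) ∧ ∀ a, v a ≤ 1 →
    ∃ g ∈ Algebra.adjoin A (F : Set L), ∃ h ∈ Algebra.adjoin A (F : Set L),
      v h = 1 ∧ v (a * h - g) < 1

/-- The field `L` is finitely generated, as a field, over `A`. -/
def FracFG (A L : Type*) [CommRing A] [Field L] [Algebra A L] : Prop :=
  ∃ F : Finset L, ∀ a : L, ∃ g ∈ Algebra.adjoin A (F : Set L),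
    ∃ h ∈ Algebra.adjoin A (F : Set L), h ≠ 0 ∧ a * h = g

variable {v : Valuation L Γ₀}

theorem valuation_aeval_le_one (hA : ∀ a : A, v (algebraMap A L a) ≤ 1) {ι : Type*} {y : ι → L}
    (hy : ∀ i, v (y i) ≤ 1) (P : MvPolynomial ι A) : v (MvPolynomial.aeval y P) ≤ 1 := by
  induction P using MvPolynomial.induction_on with
  | C a => simpa using hA a
  | add p q hp hq => rw [map_add]; exact v.map_add_le hp hq
  | mul_X p i hp => rw [map_mul, map_mul, MvPolynomial.aeval_X]; exact mul_le_one' hp (hy i)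

theorem ResIndep.valuation_eq_one {ι : Type*} {y : ι → L} (hy : ResIndep A v y) (i : ι) :
    v (y i) = 1 := by
  refine le_antisymm (hy.1 i) (not_lt.1 fun h => ?_)
  have := hy.2 (MvPolynomial.X i) (by simpa using h) (Finsupp.single i 1)
  simp at this

theorem zpow_sub_prod {ι : Type*} [Fintype ι] {x : ι → L} (hx : ∀ i, x i ≠ 0) (α β : ι → ℕ) :
    ∏ i, x i ^ ((α i : ℤ) - β i) = (∏ i, x i ^ α i) * (∏ i, x i ^ β i)⁻¹ := by
  rw [← Finset.prod_inv_distrib, ← Finset.prod_mul_distrib]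
  refine Finset.prod_congr rfl fun i _ => ?_
  rw [zpow_sub₀ (hx i), zpow_natCast, zpow_natCast, div_eq_mul_inv]

/-- Monomials in elements with independent values and residues, multiplied by elements `z i` that
are independent of them, have independent leading forms. -/
theorem leadIndep_mul_prod {ι ι' : Type*} [Fintype ι] [Fintype ι'] {N : ℕ} {x : ι → L} {y : ι' → L}
    (hx : ∀ i, x i ≠ 0) (hy : ∀ i, v (y i) = 1) {z : Fin N → L} (hz : ∀ i, z i ≠ 0)
    (hxz : ∀ i j, ∀ e : ι → ℤ, v (z i * ∏ k, x k ^ e k) = v (z j) → e = 0)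
    (hyz : ∀ (i : Fin N) (P : Fin N → MvPolynomial ι' A), (∀ j, v (z j) ≠ v (z i) → P j = 0) →
      v (∑ j, z j * MvPolynomial.aeval y (P j)) < v (z i) →
        ∀ m, v (algebraMap A L ((P i).coeff m)) < 1) :
    LeadIndep A v
      (fun q : Fin N × (ι ⊕ ι' → ℕ) => z q.1 * ∏ i, Sum.elim x y i ^ q.2 i) := by
  classical
  have hvx : ∀ i, v (x i) ≠ 0 := fun i => (Valuation.ne_zero_iff v).2 (hx i)
  have hy0 : ∀ i, y i ≠ 0 := fun i h => by simpa [h] using hy i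
  have hval : ∀ q : Fin N × (ι ⊕ ι' → ℕ), v (z q.1 * ∏ i, Sum.elim x y i ^ q.2 i) =
      v (z q.1) * v (∏ i, x i ^ q.2 (Sum.inl i)) := by
    intro q
    rw [Fintype.prod_sum_type, map_mul, map_mul]
    simp [hy]
  refine ⟨fun q => mul_ne_zero (hz _) (Finset.prod_ne_zero_iff.2 fun i _ => pow_ne_zero _ ?_),
    fun S c q₀ hq₀ h1 hS => ?_⟩
  · rcases i with i | i
    · exact hx i
    · exact hy0 i
  have hprod0 : ∀ α : ι → ℕ, v (∏ i, x i ^ α i) ≠ 0 := fun α => by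
    rw [Valuation.ne_zero_iff]
    exact Finset.prod_ne_zero_iff.2 fun i _ => pow_ne_zero _ (hx i)
  -- within one value class the exponents of the `x i` agree
  have hα : ∀ q ∈ S, ∀ i, q.2 (Sum.inl i) = q₀.2 (Sum.inl i) := by
    intro q hq
    have h := hS q hq
    rw [hval, hval] at h
    have h0 := hxz q.1 q₀.1 (fun i => (q.2 (Sum.inl i) : ℤ) - q₀.2 (Sum.inl i)) (by
      rw [zpow_sub_prod hx (fun i => q.2 (Sum.inl i)) (fun i => q₀.2 (Sum.inl i)), map_mul,
        map_mul, map_inv₀, ← mul_assoc, h, mul_assoc, mul_inv_cancel₀ (hprod0 _), mul_one])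
    intro i
    have := congrFun h0 i
    simp only [Pi.zero_apply] at this
    omega
  set m₀ := ∏ i, x i ^ q₀.2 (Sum.inl i)
  have hzS : ∀ q ∈ S, v (z q.1) = v (z q₀.1) := by
    intro q hq
    have h := hS q hq
    rw [hval, hval] at h
    simp only [hα q hq] at h
    exact mul_right_cancel₀ (hprod0 _) h
  let γ : Fin N × (ι ⊕ ι' → ℕ) → (ι' →₀ ℕ) := fun q =>
    Finsupp.equivFunOnFinite.symm fun i => q.2 (Sum.inr i)
  let P : Fin N → MvPolynomial ι' A := fun i =>
    ∑ q ∈ S.filter (fun q => q.1 = i), MvPolynomial.monomial (γ q) (c q)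
  have hsum : ∑ q ∈ S, c q • (z q.1 * ∏ i, Sum.elim x y i ^ q.2 i) =
      m₀ * ∑ j, z j * MvPolynomial.aeval y (P j) := by
    rw [← Finset.sum_fiberwise S (fun q => q.1), Finset.mul_sum]
    refine Finset.sum_congr rfl fun j _ => ?_
    rw [map_sum, Finset.mul_sum, Finset.mul_sum]
    refine Finset.sum_congr rfl fun q hq => ?_
    obtain ⟨hqS, rfl⟩ := Finset.mem_filter.1 hq
    rw [MvPolynomial.aeval_monomial, Finsupp.prod_fintype _ _ (by simp), Fintype.prod_sum_type,
      Algebra.smul_def]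
    simp only [Sum.elim_inl, Sum.elim_inr, hα q hqS, γ, Finsupp.equivFunOnFinite_symm_apply_apply]
    ring
  rw [hval, hsum, map_mul, mul_comm (v m₀)]
  refine mul_le_mul_left (not_lt.1 fun hlt => ?_) _
  have key := hyz q₀.1 P (fun j hj => ?_) hlt (γ q₀)
  · have hcoeff : (P q₀.1).coeff (γ q₀) = c q₀ := by
      simp only [P, MvPolynomial.coeff_sum, MvPolynomial.coeff_monomial]
      rw [Finset.sum_eq_single q₀]
      · simp
      · intro q hq hne
        obtain ⟨hqS, hq1⟩ := Finset.mem_filter.1 hq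
        refine if_neg fun hγ => hne (Prod.ext hq1 (funext fun i => ?_))
        rcases i with i | i
        · exact hα q hqS i
        · exact DFunLike.congr_fun hγ i
      · intro h
        exact absurd (Finset.mem_filter.2 ⟨hq₀, rfl⟩ : q₀ ∈ S.filter fun q => q.1 = q₀.1) h
    rw [hcoeff, h1] at key
    exact lt_irrefl _ key
  · refine Finset.sum_eq_zero fun q hq => ?_
    obtain ⟨hqS, rfl⟩ := Finset.mem_filter.1 hq
    exact absurd (hzS q hqS) hj

/-- A family that can be prolonged as long as it has a certain property, but not indefinitely, can
be chosen such that no prolongation has the property. -/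
theorem exists_forall_not_cons {α : Type*} (Q : ∀ N : ℕ, (Fin N → α) → Prop)
    (h0 : ∀ z, Q 0 z) (C : ℕ) (hC : ∀ N z, Q N z → N ≤ C) :
    ∃ N z, Q N z ∧ ∀ a, ¬ Q (N + 1) (Fin.cons a z) := by
  by_contra! h
  have : ∀ N, ∃ z, Q N z := by
    intro N
    induction N with
    | zero => exact ⟨Fin.elim0, h0 _⟩
    | succ N ih =>
      obtain ⟨z, hz⟩ := ih
      obtain ⟨a, ha⟩ := h N z hz
      exact ⟨_, ha⟩
  obtain ⟨z, hz⟩ := this (C + 1)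
  exact absurd (hC _ z hz) (by omega)

theorem le_of_forall_mul_pow_le {N C n₀ a b : ℕ} (hN : 0 < N)
    (h : ∀ n ≥ n₀, N * n ^ a ≤ C * n ^ b) : a ≤ b := by
  by_contra! hab
  set n := n₀ + C + 1
  have h1 := h n (by omega)
  have h2 : n ^ b * n ≤ n ^ a := by
    rw [← pow_succ]; exact Nat.pow_le_pow_right (by omega) hab
  have h3 : 0 < n ^ b := Nat.pow_pos (by omega)
  have h4 : n ^ a ≤ N * n ^ a := Nat.le_mul_of_pos_left _ hN
  have h5 : n ^ b * n ≤ n ^ b * C := by linarith [mul_comm C (n ^ b)]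
  have := Nat.le_of_mul_le_mul_left h5 h3
  omega

theorem exists_common_denominator (F : Finset L)
    (hF : ∀ a : L, ∃ g ∈ Algebra.adjoin A (F : Set L), ∃ h ∈ Algebra.adjoin A (F : Set L),
      h ≠ 0 ∧ a * h = g) {N : ℕ} (z : Fin N → L) :
    ∃ h : L, h ≠ 0 ∧ ∀ i, h * z i ∈ Algebra.adjoin A (F : Set L) := by
  choose g hg h hh h0 hgh using fun i => hF (z i)
  refine ⟨∏ i, h i, Finset.prod_ne_zero_iff.2 fun i _ => h0 i, fun i => ?_⟩
  rw [← Finset.prod_erase_mul _ _ (Finset.mem_univ i), mul_assoc, mul_comm (h i), hgh]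
  exact mul_mem (prod_mem fun j _ => hh j) (hg i)

section Cofinal

variable [IsDomain A] [IsNoetherianRing A] [FaithfulSMul A L]
  (hA : ∀ a : A, v (algebraMap A L a) ≤ 1) {s d : ℕ} (hs : Algebra.trdeg A L ≤ s)
  (hd : (centerIdeal v hA).height = d) {f : A} (hf : v (algebraMap A L f) < 1)
  (hfmax : ∀ a ∈ centerIdeal v hA, v (algebraMap A L a) ≤ v (algebraMap A L f))
  (hcof : ∀ l : L, ∃ k, v (algebraMap A L f ^ k * l) < 1)
  {ι ι' : Type*} [Fintype ι] [Fintype ι'] {x : ι → L} {y : ι' → L}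

include hA hs hd hf hfmax hcof

/-- The inequality of Abhyankar, if the powers of `f` have arbitrarily small values. -/
theorem card_add_card_le_of_cofinal (hx : RatIndep v x) (hy : ResIndep A v y) :
    Fintype.card ι + Fintype.card ι' ≤ d + s := by
  classical
  obtain ⟨C, hC⟩ := exists_card_mul_pow_le hA hs hd hf hfmax hcof
    (Finset.univ.image (Sum.elim x y)) (x := Sum.elim x y) (by simp)
  obtain ⟨n₀, hn₀⟩ := hC 1 (fun _ => 1) 1 one_ne_zero (fun _ => by simp [one_mem])
    (leadIndep_mul_prod (z := fun _ : Fin 1 => 1) hx.1 hy.valuation_eq_one (by simp)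
      (fun _ _ e he => hx.2 e (by simpa using he))
      (fun i P _ h m => by
        refine hy.2 (P i) ?_ m
        simpa [Subsingleton.elim i 0] using h))
  have := le_of_forall_mul_pow_le one_pos hn₀
  rw [Fintype.card_sum] at this
  omega

variable (hfg : FracFG A L) (hx : RatIndep v x) (hy : ResIndep A v y)
  (heq : Fintype.card ι + Fintype.card ι' = d + s)

include hfg hx hy heq

/-- In the case of equality, there is a bound on the number of elements `z i` whose products with
the monomials in the `x i` and `y i` have independent leading forms. -/
theorem exists_card_bound : ∃ C : ℕ, ∀ (N : ℕ) (z : Fin N → L), (∀ i, z i ≠ 0) →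
    (∀ i j, ∀ e : ι → ℤ, v (z i * ∏ k, x k ^ e k) = v (z j) → e = 0) →
    (∀ (i : Fin N) (P : Fin N → MvPolynomial ι' A), (∀ j, v (z j) ≠ v (z i) → P j = 0) →
      v (∑ j, z j * MvPolynomial.aeval y (P j)) < v (z i) →
        ∀ m, v (algebraMap A L ((P i).coeff m)) < 1) → N ≤ C := by
  classical
  obtain ⟨F, hF⟩ := hfg
  obtain ⟨C, hC⟩ := exists_card_mul_pow_le hA hs hd hf hfmax hcof
    (F ∪ Finset.univ.image (Sum.elim x y)) (x := Sum.elim x y)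
    (fun i => Finset.mem_union_right _ (Finset.mem_image_of_mem _ (Finset.mem_univ i)))
  refine ⟨C, fun N z hz hxz hyz => ?_⟩
  obtain ⟨h, hh, hzh⟩ := exists_common_denominator F hF z
  obtain ⟨n₀, hn₀⟩ := hC N z h hh
    (fun i => Algebra.adjoin_mono (Finset.coe_subset.2 Finset.subset_union_left) (hzh i))
    (leadIndep_mul_prod hx.1 hy.valuation_eq_one hz hxz hyz)
  have h1 := hn₀ (n₀ + 1) (Nat.le_succ _)
  rw [Fintype.card_sum, heq, add_comm d s] at h1
  exact Nat.le_of_mul_le_mul_right h1 (Nat.pow_pos (Nat.succ_pos _))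

/-- In the case of equality, the values of the `x i` generate a subgroup of finite index in the
value group. -/
theorem valFG_of_cofinal : ValFG v := by
  classical
  obtain ⟨C, hC⟩ := exists_card_bound hA hs hd hf hfmax hcof hfg hx hy heq
  -- a maximal family of elements whose values are incongruent modulo the values of the `x i`
  obtain ⟨N, z, ⟨hz0, hz⟩, hmax⟩ := exists_forall_not_cons
    (fun N (z : Fin N → L) => (∀ i, z i ≠ 0) ∧
      ∀ i j, ∀ e : ι → ℤ, v (z i * ∏ k, x k ^ e k) = v (z j) → i = j)
    (fun z => ⟨fun i => i.elim0, fun i => i.elim0⟩) C (by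
      rintro N z ⟨hz0, hz⟩
      have hvz : ∀ i, v (z i) ≠ 0 := fun i => (Valuation.ne_zero_iff v).2 (hz0 i)
      refine hC N z hz0 (fun i j e he => ?_) (fun i P hP hlt => ?_)
      · obtain rfl := hz i j e he
        rw [map_mul] at he
        exact hx.2 e (mul_left_cancel₀ (hvz i) (he.trans (mul_one _).symm))
      · refine hy.2 (P i) ?_
        have hne : ∀ j, j ≠ i → P j = 0 := fun j hj => hP j fun h => hj
          (hz j i 0 (by simpa using h))
        rw [Finset.sum_eq_single i (fun j _ hj => by simp [hne j hj]) (by simp), map_mul] at hlt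
        by_contra! h1
        exact absurd hlt (not_lt.2 (le_mul_of_one_le_right' h1)))
  let X : ι → Lˣ := fun i => Units.mk0 (x i) (hx.1 i)
  let Z : Fin N → Lˣ := fun i => Units.mk0 (z i) (hz0 i)
  have hXprod : ∀ e : ι → ℤ, ((∏ i, X i ^ e i : Lˣ) : L) = ∏ i, x i ^ e i := fun e => by
    simp [X]
  refine ⟨Set.range X ∪ Set.range Z, (Set.finite_range X).union (Set.finite_range Z), fun l => ?_⟩
  have hXmem' : ∀ i, X i ∈ Subgroup.closure (Set.range X ∪ Set.range Z) := fun i =>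
    Subgroup.subset_closure (Or.inl ⟨i, rfl⟩)
  have hXmem : ∀ e : ι → ℤ, (∏ i, X i ^ e i) ∈ Subgroup.closure (Set.range X ∪ Set.range Z) :=
    fun e => Subgroup.prod_mem _ fun i _ => Subgroup.zpow_mem _ (hXmem' i) _
  have hX0 : ∀ e : ι → ℤ, v (∏ i, x i ^ e i) ≠ 0 := fun e => by
    rw [← hXprod, Valuation.ne_zero_iff]; exact Units.ne_zero _
  have hl := hmax l
  rw [not_and] at hl
  have hl' := hl (fun i => by refine Fin.cases ?_ (fun i => ?_) i <;> simp [hz0])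
  push Not at hl'
  obtain ⟨i, j, e, he, hij⟩ := hl'
  have hZmem : ∀ i, Z i ∈ Subgroup.closure (Set.range X ∪ Set.range Z) := fun i =>
    Subgroup.subset_closure (Or.inr ⟨i, rfl⟩)
  revert he hij
  refine Fin.cases ?_ (fun i => ?_) i <;> refine Fin.cases ?_ (fun j => ?_) j
  · intro _ h; exact absurd rfl h
  · intro he _
    rw [Fin.cons_zero, Fin.cons_succ] at he
    refine ⟨Z j * (∏ i, X i ^ e i)⁻¹, mul_mem (hZmem j) (inv_mem (hXmem e)), ?_⟩
    rw [Units.val_mul, Units.val_inv_eq_inv_val, hXprod, map_mul, map_inv₀]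
    rw [map_mul] at he
    rw [eq_mul_inv_iff_mul_eq₀ (hX0 e)]
    exact he
  · intro he _
    rw [Fin.cons_zero, Fin.cons_succ] at he
    refine ⟨Z i * (∏ i, X i ^ e i), mul_mem (hZmem i) (hXmem e), ?_⟩
    rw [Units.val_mul, hXprod]
    exact he.symm
  · intro he h
    rw [Fin.cons_succ, Fin.cons_succ] at he
    exact absurd (congrArg Fin.succ (hz i j e he)) h

/-- In the case of equality, the residue field is finite over the field generated by the residues
of the `y i`. -/
theorem resFG_of_cofinal : ResFG A v := by
  classical
  obtain ⟨C, hC⟩ := exists_card_bound hA hs hd hf hfmax hcof hfg hx hy heq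
  -- a maximal family of elements whose residues are linearly independent over the residues of
  -- polynomials in the `y i`
  obtain ⟨N, z, ⟨hz1, hz⟩, hmax⟩ := exists_forall_not_cons
    (fun N (z : Fin N → L) => (∀ i, v (z i) ≤ 1) ∧ ∀ P : Fin N → MvPolynomial ι' A,
      v (∑ j, z j * MvPolynomial.aeval y (P j)) < 1 →
        ∀ i m, v (algebraMap A L ((P i).coeff m)) < 1)
    (fun z => ⟨fun i => i.elim0, fun _ _ i => i.elim0⟩) C (by
      rintro N z ⟨hz1, hz⟩
      have hz1' : ∀ i, v (z i) = 1 := fun i => by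
        refine le_antisymm (hz1 i) (not_lt.1 fun h => ?_)
        have := hz (Pi.single i 1) (by
          rw [Finset.sum_eq_single i (fun j _ hj => by simp [Pi.single_eq_of_ne hj]) (by simp)]
          simpa using h) i 0
        simp at this
      refine hC N z (fun i h => by simpa [h] using hz1' i) (fun i j e he => ?_)
        (fun i P _ hlt => hz P (by rwa [hz1' i] at hlt) i)
      rw [map_mul, hz1', hz1', one_mul] at he
      exact hx.2 e he)
  set F : Finset L := Finset.univ.image y ∪ Finset.univ.image z
  have hyF : ∀ i, y i ∈ Algebra.adjoin A (F : Set L) := fun i =>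
    Algebra.subset_adjoin (Finset.mem_coe.2 (Finset.mem_union_left _
      (Finset.mem_image_of_mem _ (Finset.mem_univ i))))
  have hzF : ∀ i, z i ∈ Algebra.adjoin A (F : Set L) := fun i =>
    Algebra.subset_adjoin (Finset.mem_coe.2 (Finset.mem_union_right _
      (Finset.mem_image_of_mem _ (Finset.mem_univ i))))
  have hPF : ∀ P : MvPolynomial ι' A, MvPolynomial.aeval y P ∈ Algebra.adjoin A (F : Set L) := by
    intro P
    have h1 : MvPolynomial.aeval y P ∈ Algebra.adjoin A (Set.range y) := by
      rw [Algebra.adjoin_range_eq_range_aeval]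
      exact ⟨P, rfl⟩
    refine Algebra.adjoin_le ?_ h1
    rintro _ ⟨i, rfl⟩
    exact hyF i
  refine ⟨F, ?_, fun a ha => ?_⟩
  · intro w hw
    rcases Finset.mem_union.1 hw with hw | hw <;> obtain ⟨i, -, rfl⟩ := Finset.mem_image.1 hw
    exacts [hy.1 i, hz1 i]
  have hl := hmax a
  rw [not_and] at hl
  have hl' := hl (fun i => by refine Fin.cases ?_ (fun i => ?_) i <;> simp [hz1, ha])
  push Not at hl'
  obtain ⟨P, hP, i, m, him⟩ := hl'
  rw [Fin.sum_univ_succ] at hP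
  simp only [Fin.cons_zero, Fin.cons_succ] at hP
  -- the coefficient of `a` in the relation is a unit, since the `z j` are independent
  have hu : v (MvPolynomial.aeval y (P 0)) = 1 := by
    refine le_antisymm (valuation_aeval_le_one hA hy.1 _) (not_lt.1 fun hlt => ?_)
    have h1 : v (∑ j : Fin N, z j * MvPolynomial.aeval y (P j.succ)) < 1 := by
      have h2 := v.map_sub_lt hP (show v (a * MvPolynomial.aeval y (P 0)) < 1 by
        rw [map_mul]; exact lt_of_le_of_lt (mul_le_of_le_one_left' ha) hlt)
      rwa [add_sub_cancel_left] at h2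
    revert him
    rw [imp_false, not_le]
    refine Fin.cases (hy.2 _ hlt m) (fun i => ?_) i
    exact hz (fun j => P j.succ) h1 i m
  refine ⟨- ∑ j : Fin N, z j * MvPolynomial.aeval y (P j.succ),
    neg_mem (sum_mem fun j _ => mul_mem (hzF j) (hPF _)), _, hPF (P 0), hu, ?_⟩
  rwa [sub_neg_eq_add]

end Cofinal

end Indep

/-! ### Composite valuations -/

/-- A chain of primes of `A₁` that ends in `Q` can be put on top of a chain of primes of `A` that
ends in `p`. -/
theorem add_height_le_height_comap {A A₁ : Type*} [CommRing A] [CommRing A₁] {π : A →+* A₁}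
    (hπ : Function.Surjective π) (p : Ideal A) (hp : p ≤ RingHom.ker π) (n : ℕ) :
    ∀ Q : Ideal A₁, Q.IsPrime → n ≤ Q.height → n + p.height ≤ (Q.comap π).height := by
  induction n with
  | zero =>
    intro Q _ _
    rw [Nat.cast_zero, zero_add]
    exact Ideal.height_mono (hp.trans (Ideal.ker_le_comap π))
  | succ n ih =>
    intro Q hQ hn
    have h1 : ¬ Q.height ≤ n := fun h => by
      have := hn.trans h
      norm_cast at this
      omega
    rw [Ideal.height_le_iff] at h1
    push Not at h1
    obtain ⟨q, hq, hqQ, hnq⟩ := h1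
    have h2 := ih q hq hnq
    have hlt : q.comap π < Q.comap π := by
      refine lt_of_le_of_ne (Ideal.comap_mono hqQ.le) fun h => hqQ.ne ?_
      exact Ideal.comap_injective_of_surjective π hπ h
    have h3 := Ideal.height_add_one_le_of_lt_of_isPrime hlt
    calc ((n + 1 : ℕ) : ℕ∞) + p.height = (n + p.height) + 1 := by push_cast; ring
      _ ≤ (q.comap π).height + 1 := add_le_add_left h2 1
      _ ≤ _ := h3

section Rank

variable {L Γ₀ : Type*} [Field L] [LinearOrderedCommGroupWithZero Γ₀]

/-- The value of a nonzero element, as an element of an additive group. -/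
def valClass (v : Valuation L Γ₀) (l : Lˣ) : Additive Γ₀ˣ :=
  Additive.ofMul (Units.map (v : L →* Γ₀) l)

theorem valClass_eq_zero_iff {v : Valuation L Γ₀} {l : Lˣ} : valClass v l = 0 ↔ v l = 1 := by
  rw [valClass, ofMul_eq_zero, Units.ext_iff]
  rfl

theorem sum_smul_valClass {v : Valuation L Γ₀} {ι : Type*} [Fintype ι] (x : ι → Lˣ) (e : ι → ℤ) :
    ∑ i, e i • valClass v (x i) = valClass v (∏ i, x i ^ e i) := by
  simp only [valClass, map_prod, map_zpow, ofMul_prod, ofMul_zpow]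

theorem linearIndependent_valClass_iff {v : Valuation L Γ₀} {ι : Type*} [Fintype ι] {x : ι → Lˣ} :
    LinearIndependent ℤ (fun i => valClass v (x i)) ↔ RatIndep v fun i => (x i : L) := by
  rw [Fintype.linearIndependent_iff]
  simp only [sum_smul_valClass, valClass_eq_zero_iff, RatIndep, Units.coe_prod,
    Units.val_zpow_eq_zpow_val]
  exact ⟨fun h => ⟨fun i => Units.ne_zero _, fun e he => funext (h e he)⟩,
    fun h e he i => congrFun (h.2 e he) i⟩

theorem RatIndep.linearIndependent {v : Valuation L Γ₀} {ι : Type*} [Fintype ι] {x : ι → L}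
    (hx : RatIndep v x) :
    LinearIndependent ℤ fun i => valClass v (Units.mk0 (x i) (hx.1 i)) :=
  linearIndependent_valClass_iff.2 hx

theorem exists_valClass_eq {V : ValuationSubring L} (g : Additive V.ValueGroupˣ) :
    ∃ l : Lˣ, valClass V.valuation l = g := by
  obtain ⟨l, hl⟩ := V.valuation_surjective (Additive.toMul g : V.ValueGroupˣ)
  have h0 : l ≠ 0 := fun h => by
    rw [h, map_zero] at hl
    exact Units.ne_zero _ hl.symm
  exact ⟨Units.mk0 l h0, congrArg Additive.ofMul (Units.ext hl)⟩

theorem rank_le_of_forall_ratIndep {V : ValuationSubring L} (n : ℕ)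
    (N : Submodule ℤ (Additive V.ValueGroupˣ))
    (h : ∀ (r : ℕ) (x : Fin r → Lˣ), (∀ i, valClass V.valuation (x i) ∈ N) →
      RatIndep V.valuation (fun i => (x i : L)) → r ≤ n) : Module.rank ℤ N ≤ n := by
  refine rank_le fun s hs => ?_
  choose l hl using fun g => exists_valClass_eq (V := V) g
  let f : Fin s.card → s := s.equivFin.symm
  refine h s.card (fun i => l (f i : N)) (fun i => by rw [hl]; exact Subtype.property _) ?_
  rw [← linearIndependent_valClass_iff]
  simp only [hl]
  have := (hs.comp f s.equivFin.symm.injective).map' N.subtype (Submodule.ker_subtype N)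
  exact this

end Rank

section Composite

variable {L : Type*} [Field L] {V V₁ : ValuationSubring L} (hV : V ≤ V₁)

include hV in
theorem valuation_le_one_of_le {a : L} (ha : V.valuation a ≤ 1) : V₁.valuation a ≤ 1 := by
  rw [ValuationSubring.valuation_le_one_iff] at *
  exact hV ha

include hV in
theorem valuation_lt_one_of_le {a : L} (ha : V₁.valuation a < 1) : V.valuation a < 1 := by
  rw [← ValuationSubring.mem_nonunits_iff] at *
  exact ValuationSubring.nonunits_le_nonunits.2 hV ha

/-- If `V` is contained in `V₁`, then `V` is the composite of `V₁` with a valuation ring of the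
residue field of `V₁`: the image of `V`. -/
def residueValuationSubring : ValuationSubring (IsLocalRing.ResidueField V₁) :=
  ValuationSubring.ofSubring
    (((V.inclusion V₁ hV).range).map (IsLocalRing.residue V₁)) (by
      intro c
      obtain ⟨a, rfl⟩ := IsLocalRing.residue_surjective c
      rcases V.mem_or_inv_mem a with h | h
      · exact Or.inl ⟨a, ⟨⟨a, h⟩, rfl⟩, rfl⟩
      · by_cases ha : IsLocalRing.residue V₁ a = 0
        · exact Or.inl (ha ▸ Subring.zero_mem _)
        · right
          refine ⟨V.inclusion V₁ hV ⟨_, h⟩, ⟨⟨_, h⟩, rfl⟩, ?_⟩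
          refine eq_inv_of_mul_eq_one_left ?_
          rw [← map_mul, ← map_one (IsLocalRing.residue V₁)]
          congr 1
          refine Subtype.ext (inv_mul_cancel₀ fun h0 => ha ?_)
          rw [show a = 0 from Subtype.ext h0, map_zero])

/-- The valuation of the residue field of `V₁` attached to `residueValuationSubring`. -/
abbrev residueValuation := (residueValuationSubring hV).valuation

theorem residueValuation_le_one_iff {a : V₁} :
    residueValuation hV (IsLocalRing.residue V₁ a) ≤ 1 ↔ V.valuation (a : L) ≤ 1 := by
  rw [ValuationSubring.valuation_le_one_iff, ValuationSubring.valuation_le_one_iff]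
  constructor
  · rintro ⟨_, ⟨b, rfl⟩, hb⟩
    have h1 : V.inclusion V₁ hV b - a ∈ IsLocalRing.maximalIdeal V₁ := by
      rw [← IsLocalRing.residue_eq_zero_iff, map_sub, hb, sub_self]
    rw [ValuationSubring.valuation_lt_one_iff] at h1
    have h2 : (b : L) - a ∈ V := by
      rw [← ValuationSubring.valuation_le_one_iff]
      exact (valuation_lt_one_of_le hV h1).le
    have := V.sub_mem b.2 h2
    rwa [sub_sub_cancel] at this
  · intro h
    exact ⟨a, ⟨⟨a, h⟩, rfl⟩, rfl⟩

theorem residue_ne_zero_of_valuation_eq_one {a : V₁} (ha : V₁.valuation (a : L) = 1) :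
    IsLocalRing.residue V₁ a ≠ 0 := by
  rw [Ne, IsLocalRing.residue_eq_zero_iff, ValuationSubring.valuation_lt_one_iff, ha]
  exact lt_irrefl _

theorem residueValuation_lt_one_iff {a : V₁} :
    residueValuation hV (IsLocalRing.residue V₁ a) < 1 ↔ V.valuation (a : L) < 1 := by
  by_cases h0 : V₁.valuation (a : L) < 1
  · have : IsLocalRing.residue V₁ a = 0 := by
      rw [IsLocalRing.residue_eq_zero_iff, ValuationSubring.valuation_lt_one_iff]; exact h0
    simp [this, valuation_lt_one_of_le hV h0]
  · have h1 : V₁.valuation (a : L) = 1 := le_antisymm (V₁.valuation_le_one a) (not_lt.1 h0)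
    have hne := residue_ne_zero_of_valuation_eq_one h1
    have ha0 : (a : L) ≠ 0 := fun h => by simp [h] at h1
    have hinv : V₁.valuation (a : L)⁻¹ ≤ 1 := by rw [map_inv₀, h1, inv_one]
    let b : V₁ := ⟨(a : L)⁻¹, (V₁.valuation_le_one_iff _).1 hinv⟩
    have hb : IsLocalRing.residue V₁ b = (IsLocalRing.residue V₁ a)⁻¹ := by
      refine eq_inv_of_mul_eq_one_left ?_
      rw [← map_mul, ← map_one (IsLocalRing.residue V₁)]
      congr 1
      exact Subtype.ext (inv_mul_cancel₀ ha0)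
    have key := residueValuation_le_one_iff hV (a := b)
    rw [hb, map_inv₀, map_inv₀,
      inv_le_one₀ (zero_lt_iff.2 ((Valuation.ne_zero_iff _).2 hne)),
      inv_le_one₀ (zero_lt_iff.2 ((Valuation.ne_zero_iff _).2 ha0))] at key
    rw [← not_le, key, not_le]

theorem residueValuation_eq_one_iff {a : V₁} :
    residueValuation hV (IsLocalRing.residue V₁ a) = 1 ↔ V.valuation (a : L) = 1 := by
  rw [le_antisymm_iff, le_antisymm_iff]
  exact and_congr (residueValuation_le_one_iff hV)
    (by rw [← not_lt, residueValuation_lt_one_iff, not_lt])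

include hV in
/-- The rational rank of the value group of a composite valuation is at most the sum of the
rational ranks of the two constituents. -/
theorem card_le_add_of_composite {r₁ r₂ : ℕ}
    (h₁ : ∀ (n : ℕ) (x : Fin n → L), RatIndep V₁.valuation x → n ≤ r₁)
    (h₂ : ∀ (n : ℕ) (x : Fin n → IsLocalRing.ResidueField V₁),
      RatIndep (residueValuation hV) x → n ≤ r₂)
    {ι : Type*} [Fintype ι] {x : ι → L} (hx : RatIndep V.valuation x) :
    Fintype.card ι ≤ r₁ + r₂ := by
  have hmap : ∀ l : L, V.mapOfLE V₁ hV (V.valuation l) = V₁.valuation l :=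
    ValuationSubring.mapOfLE_valuation_apply V V₁ hV
  let φ : Additive V.ValueGroupˣ →ₗ[ℤ] Additive V₁.ValueGroupˣ :=
    (MonoidHom.toAdditive
      (Units.map ((V.mapOfLE V₁ hV : V.ValueGroup →*₀ V₁.ValueGroup) :
        V.ValueGroup →* V₁.ValueGroup))).toIntLinearMap
  have hφ : ∀ l : Lˣ, φ (valClass V.valuation l) = valClass V₁.valuation l := fun l =>
    congrArg Additive.ofMul (Units.ext (hmap l))
  have hrange : Module.rank ℤ (LinearMap.range φ) ≤ r₁ :=
    rank_le_of_forall_ratIndep r₁ _ fun r x _ hx => h₁ r _ hx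
  have hker : Module.rank ℤ (LinearMap.ker φ) ≤ r₂ := by
    refine rank_le_of_forall_ratIndep r₂ _ fun r x hxk hx => ?_
    have hx1 : ∀ i, V₁.valuation (x i : L) = 1 := fun i => by
      have := hxk i
      rwa [LinearMap.mem_ker, hφ, valClass_eq_zero_iff] at this
    let a : Fin r → V₁ := fun i => ⟨x i, (V₁.valuation_le_one_iff _).1 (hx1 i).le⟩
    have hne : ∀ i, IsLocalRing.residue V₁ (a i) ≠ 0 := fun i =>
      residue_ne_zero_of_valuation_eq_one (hx1 i)
    refine h₂ r (fun i => IsLocalRing.residue V₁ (a i)) ⟨hne, fun e he => hx.2 e ?_⟩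
    -- units of `V₁` lifting the residues
    have hu : ∀ i, IsUnit (a i) := fun i => (V₁.valuation_eq_one_iff _).2 (hx1 i)
    let u : Fin r → V₁ˣ := fun i => (hu i).unit
    have h3 : ∏ i, IsLocalRing.residue V₁ (a i) ^ e i =
        IsLocalRing.residue V₁ ((∏ i, u i ^ e i : V₁ˣ) : V₁) := by
      have : ((Units.map (IsLocalRing.residue V₁ : V₁ →* _) (∏ i, u i ^ e i) :
          (IsLocalRing.ResidueField V₁)ˣ) : IsLocalRing.ResidueField V₁) =
          IsLocalRing.residue V₁ ((∏ i, u i ^ e i : V₁ˣ) : V₁) := rfl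
      rw [← this, map_prod, Units.coe_prod]
      refine Finset.prod_congr rfl fun i _ => ?_
      rw [map_zpow, Units.val_zpow_eq_zpow_val]
      rfl
    have h4 : (((∏ i, u i ^ e i : V₁ˣ) : V₁) : L) = ∏ i, (x i : L) ^ e i := by
      have : ((Units.map (V₁.subtype : V₁ →* L) (∏ i, u i ^ e i) : Lˣ) : L) =
          (((∏ i, u i ^ e i : V₁ˣ) : V₁) : L) := rfl
      rw [← this, map_prod, Units.coe_prod]
      refine Finset.prod_congr rfl fun i _ => ?_
      rw [map_zpow, Units.val_zpow_eq_zpow_val]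
      rfl
    rw [h3, residueValuation_eq_one_iff, h4] at he
    exact he
  have hrk : (Fintype.card ι : Cardinal) ≤ Module.rank ℤ (Additive V.ValueGroupˣ) := by
    have := hx.linearIndependent.cardinal_lift_le_rank
    simpa using this
  have hsum := LinearMap.lift_rank_range_add_rank_ker φ
  have hcard : (Cardinal.lift (Fintype.card ι : Cardinal)) ≤ ((r₁ + r₂ : ℕ) : Cardinal) := by
    refine (Cardinal.lift_le.2 hrk).trans ?_
    rw [← hsum]
    push_cast
    refine add_le_add ?_ ?_
    · simpa using hrange
    · simpa using hker
  rw [Cardinal.lift_natCast] at hcard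
  exact_mod_cast hcard

include hV in
theorem valFG_of_composite (h₁ : ValFG V₁.valuation) (h₂ : ValFG (residueValuation hV)) :
    ValFG V.valuation := by
  obtain ⟨S, hS, hSg⟩ := h₁
  obtain ⟨S', hS', hSg'⟩ := h₂
  have hlift : ∀ c : (IsLocalRing.ResidueField V₁)ˣ, ∃ u : V₁ˣ,
      Units.map (IsLocalRing.residue V₁ : V₁ →* _) u = c := fun c =>
    IsLocalRing.surjective_units_map_of_local_ringHom (IsLocalRing.residue V₁)
      IsLocalRing.residue_surjective inferInstance c
  choose w hw using hlift
  let j : V₁ˣ →* Lˣ := Units.map (V₁.subtype : V₁ →* L)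
  refine ⟨S ∪ j '' (w '' S'), hS.union ((hS'.image _).image _), fun l => ?_⟩
  obtain ⟨g, hg, hlg⟩ := hSg l
  have h1 : V₁.valuation ((l * g⁻¹ : Lˣ) : L) = 1 := by
    rw [Units.val_mul, map_mul, hlg, Units.val_inv_eq_inv_val, map_inv₀]
    exact mul_inv_cancel₀ ((Valuation.ne_zero_iff _).2 g.ne_zero)
  let a : V₁ := ⟨((l * g⁻¹ : Lˣ) : L), (V₁.valuation_le_one_iff _).1 h1.le⟩
  have ha : IsUnit a := (V₁.valuation_eq_one_iff _).2 h1
  obtain ⟨c, hc, hac⟩ := hSg' (Units.map (IsLocalRing.residue V₁ : V₁ →* _) ha.unit)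
  -- lift the element `c` of the subgroup generated by `S'` to the subgroup generated by `w '' S'`
  have hcl : ∃ u ∈ Subgroup.closure (w '' S'),
      Units.map (IsLocalRing.residue V₁ : V₁ →* _) u = c := by
    have : Subgroup.closure S' ≤
        (Subgroup.closure (w '' S')).map (Units.map (IsLocalRing.residue V₁ : V₁ →* _)) := by
      rw [Subgroup.closure_le]
      intro s hs
      exact ⟨w s, Subgroup.subset_closure ⟨s, hs, rfl⟩, hw s⟩
    exact this hc
  obtain ⟨u, hu, rfl⟩ := hcl
  refine ⟨j u * g, mul_mem ?_ (Subgroup.closure_mono Set.subset_union_left hg), ?_⟩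
  · have : Subgroup.closure (w '' S') ≤ (Subgroup.closure (S ∪ j '' (w '' S'))).comap j := by
      rw [Subgroup.closure_le]
      intro s hs
      exact Subgroup.subset_closure (Or.inr ⟨s, hs, rfl⟩)
    exact this hu
  · have hq : residueValuation hV (IsLocalRing.residue V₁ ((ha.unit * u⁻¹ : V₁ˣ) : V₁)) = 1 := by
      have e1 : IsLocalRing.residue V₁ ((ha.unit * u⁻¹ : V₁ˣ) : V₁) =
        ((Units.map (IsLocalRing.residue V₁ : V₁ →* _) ha.unit *
          (Units.map (IsLocalRing.residue V₁ : V₁ →* _) u)⁻¹ :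
          (IsLocalRing.ResidueField V₁)ˣ) : IsLocalRing.ResidueField V₁) := by
        rw [← map_inv, ← map_mul]; rfl
      rw [e1, Units.val_mul, map_mul, hac, Units.val_inv_eq_inv_val, map_inv₀]
      exact mul_inv_cancel₀ ((Valuation.ne_zero_iff _).2 (Units.ne_zero _))
    rw [residueValuation_eq_one_iff] at hq
    have e2 : (((ha.unit * u⁻¹ : V₁ˣ) : V₁) : L) = ((l * g⁻¹ * (j u)⁻¹ : Lˣ) : L) := by
      rw [← map_inv]; rfl
    rw [e2] at hq
    have e3 : (l : L) = ((l * g⁻¹ * (j u)⁻¹ : Lˣ) : L) * ((j u * g : Lˣ) : L) := by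
      rw [← Units.val_mul]
      congr 1
      group
    rw [e3, map_mul, hq, one_mul]

section Algebra

variable {A A₁ : Type*} [CommRing A] [Algebra A L] [CommRing A₁]
  [Algebra A₁ (IsLocalRing.ResidueField V₁)] {π : A →+* A₁} (hπ : Function.Surjective π)
  (hA : ∀ a : A, algebraMap A L a ∈ V₁)
  (hcomm : ∀ a : A, algebraMap A₁ (IsLocalRing.ResidueField V₁) (π a) =
    IsLocalRing.residue V₁ ⟨algebraMap A L a, hA a⟩)

include hcomm

/-- The residue of a polynomial expression in elements of `V₁` is the expression in their residues
with the images of the coefficients under `π`. -/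
theorem residue_aeval {ι : Type*} (y : ι → V₁) (P : MvPolynomial ι A) :
    ∃ h : MvPolynomial.aeval (fun i => (y i : L)) P ∈ V₁,
      MvPolynomial.aeval (fun i => IsLocalRing.residue V₁ (y i)) (P.map π) =
        IsLocalRing.residue V₁ ⟨_, h⟩ := by
  induction P using MvPolynomial.induction_on with
  | C a =>
    refine ⟨by simpa using hA a, ?_⟩
    rw [MvPolynomial.map_C, MvPolynomial.aeval_C, hcomm]
    simp
  | add p q hp hq =>
    obtain ⟨hp, hp'⟩ := hp
    obtain ⟨hq, hq'⟩ := hq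
    refine ⟨by rw [map_add]; exact add_mem hp hq, ?_⟩
    rw [map_add, map_add, hp', hq', ← map_add]
    congr 1
    exact Subtype.ext (map_add _ p q).symm
  | mul_X p i hp =>
    obtain ⟨hp, hp'⟩ := hp
    refine ⟨by rw [map_mul, MvPolynomial.aeval_X]; exact mul_mem hp (y i).2, ?_⟩
    rw [map_mul, map_mul, MvPolynomial.map_X, MvPolynomial.aeval_X, hp', ← map_mul]
    congr 1
    refine Subtype.ext ?_
    simp

include hπ

theorem resIndep_residue {ι : Type*} {y : ι → V₁}
    (hy : ResIndep A V.valuation fun i => (y i : L)) :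
    ResIndep A₁ (residueValuation hV) fun i => IsLocalRing.residue V₁ (y i) := by
  refine ⟨fun i => (residueValuation_le_one_iff hV).2 (hy.1 i), fun P hP m => ?_⟩
  obtain ⟨P, rfl⟩ := MvPolynomial.map_surjective π hπ P
  obtain ⟨h, h'⟩ := residue_aeval hA hcomm y P
  rw [h', residueValuation_lt_one_iff] at hP
  rw [MvPolynomial.coeff_map, hcomm, residueValuation_lt_one_iff]
  exact hy.2 P hP m

omit hπ in
theorem resIndep_of_algebraicIndependent {ι : Type*} {y : ι → V₁}
    (hy : AlgebraicIndependent A₁ fun i => IsLocalRing.residue V₁ (y i)) :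
    ResIndep A V₁.valuation fun i => (y i : L) := by
  refine ⟨fun i => V₁.valuation_le_one _, fun P hP m => ?_⟩
  obtain ⟨h, h'⟩ := residue_aeval hA hcomm y P
  have h0 : IsLocalRing.residue V₁ ⟨_, h⟩ = 0 := by
    rw [IsLocalRing.residue_eq_zero_iff, ValuationSubring.valuation_lt_one_iff]; exact hP
  rw [h0] at h'
  have hP0 := hy.eq_zero_of_aeval_eq_zero _ h'
  have hm : π (P.coeff m) = 0 := by rw [← MvPolynomial.coeff_map, hP0, MvPolynomial.coeff_zero]
  have := hcomm (P.coeff m)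
  rw [hm, map_zero, eq_comm, IsLocalRing.residue_eq_zero_iff,
    ValuationSubring.valuation_lt_one_iff] at this
  exact this

omit hπ in
theorem residue_mem_adjoin {F : Set L} (hF : ∀ w ∈ F, w ∈ V₁) {a : L}
    (ha : a ∈ Algebra.adjoin A F) :
    ∃ h : a ∈ V₁, IsLocalRing.residue V₁ ⟨a, h⟩ ∈
      Algebra.adjoin A₁ {c | ∃ b : V₁, (b : L) ∈ F ∧ IsLocalRing.residue V₁ b = c} := by
  induction ha using Algebra.adjoin_induction with
  | mem x hx => exact ⟨hF x hx, Algebra.subset_adjoin ⟨⟨x, _⟩, hx, rfl⟩⟩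
  | algebraMap a => exact ⟨hA a, by rw [← hcomm]; exact Subalgebra.algebraMap_mem _ _⟩
  | add x y _ _ hx hy =>
    obtain ⟨hx, hx'⟩ := hx
    obtain ⟨hy, hy'⟩ := hy
    exact ⟨add_mem hx hy, by
      have := add_mem hx' hy'
      rwa [← map_add] at this⟩
  | mul x y _ _ hx hy =>
    obtain ⟨hx, hx'⟩ := hx
    obtain ⟨hy, hy'⟩ := hy
    exact ⟨mul_mem hx hy, by
      have := mul_mem hx' hy'
      rwa [← map_mul] at this⟩

omit hπ in
theorem fracFG_residueField (h : ResFG A V₁.valuation) :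
    FracFG A₁ (IsLocalRing.ResidueField V₁) := by
  classical
  obtain ⟨F, hF, hFg⟩ := h
  have hF' : ∀ w ∈ (F : Set L), w ∈ V₁ := fun w hw => (V₁.valuation_le_one_iff _).1 (hF w hw)
  have hfin : {c | ∃ b : V₁, (b : L) ∈ (F : Set L) ∧ IsLocalRing.residue V₁ b = c}.Finite := by
    have h1 : {b : V₁ | (b : L) ∈ (F : Set L)}.Finite :=
      F.finite_toSet.preimage Subtype.val_injective.injOn
    exact h1.image _
  refine ⟨hfin.toFinset, fun c => ?_⟩
  obtain ⟨a, rfl⟩ := IsLocalRing.residue_surjective c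
  obtain ⟨g, hg, k, hk, hk1, hak⟩ := hFg a (V₁.valuation_le_one a)
  obtain ⟨hg1, hg2⟩ := residue_mem_adjoin hA hcomm hF' hg
  obtain ⟨hk2, hk3⟩ := residue_mem_adjoin hA hcomm hF' hk
  rw [hfin.coe_toFinset]
  refine ⟨_, hg2, _, hk3, residue_ne_zero_of_valuation_eq_one hk1, ?_⟩
  rw [← map_mul, ← sub_eq_zero, ← map_sub, IsLocalRing.residue_eq_zero_iff,
    ValuationSubring.valuation_lt_one_iff]
  exact hak

include hV in
theorem resFG_of_composite (h : ResFG A₁ (residueValuation hV)) : ResFG A V.valuation := by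
  classical
  obtain ⟨F, hF, hFg⟩ := h
  choose w hw using IsLocalRing.residue_surjective (R := V₁)
  set F' : Finset L := F.image fun c => (w c : L)
  -- lift elements of the algebra generated by `F`
  have hlift : ∀ c ∈ Algebra.adjoin A₁ (F : Set (IsLocalRing.ResidueField V₁)),
      ∃ a : V₁, (a : L) ∈ Algebra.adjoin A (F' : Set L) ∧ IsLocalRing.residue V₁ a = c := by
    intro c hc
    induction hc using Algebra.adjoin_induction with
    | mem c hc =>
      exact ⟨w c, Algebra.subset_adjoin (Finset.mem_coe.2 (Finset.mem_image_of_mem _ hc)), hw c⟩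
    | algebraMap a =>
      obtain ⟨a, rfl⟩ := hπ a
      exact ⟨⟨_, hA a⟩, Subalgebra.algebraMap_mem _ _, (hcomm a).symm⟩
    | add x y _ _ hx hy =>
      obtain ⟨a, ha, rfl⟩ := hx
      obtain ⟨b, hb, rfl⟩ := hy
      exact ⟨a + b, add_mem ha hb, map_add _ _ _⟩
    | mul x y _ _ hx hy =>
      obtain ⟨a, ha, rfl⟩ := hx
      obtain ⟨b, hb, rfl⟩ := hy
      exact ⟨a * b, mul_mem ha hb, map_mul _ _ _⟩
  refine ⟨F', fun l hl => ?_, fun a ha => ?_⟩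
  · obtain ⟨c, hc, rfl⟩ := Finset.mem_image.1 hl
    rw [← residueValuation_le_one_iff hV, hw]
    exact hF c hc
  · let a' : V₁ := ⟨a, hV ((V.valuation_le_one_iff a).1 ha)⟩
    obtain ⟨g, hg, k, hk, hk1, hak⟩ := hFg (IsLocalRing.residue V₁ a')
      ((residueValuation_le_one_iff hV).2 ha)
    obtain ⟨g, hg', rfl⟩ := hlift g hg
    obtain ⟨k, hk', rfl⟩ := hlift k hk
    rw [residueValuation_eq_one_iff] at hk1
    rw [← map_mul, ← map_sub, residueValuation_lt_one_iff] at hak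
    exact ⟨g, hg', k, hk', hk1, hak⟩

end Algebra

end Composite

/-! ### Abhyankar's inequality and the case of equality -/

section Abhyankar

variable {A L : Type*} [CommRing A] [Field L] [Algebra A L]

/-- The center contains an element of largest value, namely one of finitely many generators. It is
`0` if the center is. -/
theorem exists_maximal_center [IsNoetherianRing A] {Γ₀ : Type*}
    [LinearOrderedCommGroupWithZero Γ₀] {v : Valuation L Γ₀}
    (hA : ∀ a : A, v (algebraMap A L a) ≤ 1) :
    ∃ f ∈ centerIdeal v hA, ∀ a ∈ centerIdeal v hA,
      v (algebraMap A L a) ≤ v (algebraMap A L f) := by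
  classical
  obtain ⟨S, hS⟩ := IsNoetherian.noetherian (centerIdeal v hA)
  obtain ⟨f, hf, hmax⟩ := Finset.exists_max_image (insert 0 S)
    (fun a => v (algebraMap A L a)) ⟨0, Finset.mem_insert_self _ _⟩
  refine ⟨f, ?_, fun a ha => ?_⟩
  · rcases Finset.mem_insert.1 hf with rfl | hf
    · exact Ideal.zero_mem _
    · rw [← hS]; exact Submodule.subset_span hf
  · rw [← hS] at ha
    refine Submodule.span_induction (fun a ha => hmax a (Finset.mem_insert_of_mem ha))
      (by simp) ?_ ?_ ha
    · intro a b _ _ ha hb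
      rw [map_add]; exact v.map_add_le ha hb
    · intro c a _ ha
      rw [smul_eq_mul, map_mul, map_mul]
      exact (mul_le_of_le_one_left' (hA c)).trans ha

/-- The valuation ring obtained from `V` by inverting the nonzero element `f` of `V`. -/
def invertSubring (V : ValuationSubring L) (f : L) (hf : V.valuation f ≤ 1) :
    ValuationSubring L where
  carrier := {l | ∃ k : ℕ, V.valuation (f ^ k * l) ≤ 1}
  mul_mem' := by
    rintro a b ⟨k, hk⟩ ⟨m, hm⟩
    refine ⟨k + m, ?_⟩
    rw [pow_add, mul_mul_mul_comm, map_mul]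
    exact mul_le_one' hk hm
  one_mem' := ⟨0, by simp⟩
  add_mem' := by
    rintro a b ⟨k, hk⟩ ⟨m, hm⟩
    refine ⟨k + m, ?_⟩
    rw [mul_add]
    refine Valuation.map_add_le _ ?_ ?_
    · rw [add_comm, pow_add, mul_assoc, map_mul]
      exact mul_le_one' (by rw [map_pow]; exact pow_le_one' hf _) hk
    · rw [pow_add, mul_assoc, map_mul]
      exact mul_le_one' (by rw [map_pow]; exact pow_le_one' hf _) hm
  zero_mem' := ⟨0, by simp⟩
  neg_mem' := by
    rintro a ⟨k, hk⟩
    exact ⟨k, by rwa [mul_neg, Valuation.map_neg]⟩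
  mem_or_inv_mem' a := by
    rcases V.mem_or_inv_mem a with h | h
    · exact Or.inl ⟨0, by simpa [V.valuation_le_one_iff] using h⟩
    · exact Or.inr ⟨0, by simpa only [pow_zero, one_mul, V.valuation_le_one_iff] using h⟩

theorem mem_invertSubring {V : ValuationSubring L} {f : L} {hf : V.valuation f ≤ 1} {l : L} :
    l ∈ invertSubring V f hf ↔ ∃ k : ℕ, V.valuation (f ^ k * l) ≤ 1 := Iff.rfl

theorem le_invertSubring {V : ValuationSubring L} {f : L} {hf : V.valuation f ≤ 1} :
    V ≤ invertSubring V f hf := fun l hl =>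
  ⟨0, by simpa only [pow_zero, one_mul, V.valuation_le_one_iff] using hl⟩

theorem valuation_invertSubring {V : ValuationSubring L} {f : L} {hf : V.valuation f ≤ 1}
    (h0 : f ≠ 0) : (invertSubring V f hf).valuation f = 1 := by
  have h1 : (invertSubring V f hf).valuation f ≤ 1 :=
    valuation_le_one_of_le le_invertSubring hf
  have h2 : (invertSubring V f hf).valuation f⁻¹ ≤ 1 := by
    rw [ValuationSubring.valuation_le_one_iff]
    exact ⟨1, by simp [h0]⟩
  rw [map_inv₀, inv_le_one₀ (zero_lt_iff.2 ((Valuation.ne_zero_iff _).2 h0))] at h2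
  exact le_antisymm h1 h2

/-- If the algebraically independent finite families in a field `k` are bounded, then `k` has a
finite transcendence basis. -/
theorem exists_finite_transcendenceBasis {B k : Type*} [CommRing B] [IsDomain B] [Field k]
    [Algebra B k] [FaithfulSMul B k] (C : ℕ)
    (hC : ∀ (m : ℕ) (y : Fin m → k), AlgebraicIndependent B y → m ≤ C) :
    ∃ (t : ℕ) (y : Fin t → k), AlgebraicIndependent B y ∧ Algebra.trdeg B k = t := by
  obtain ⟨T, hT⟩ := exists_isTranscendenceBasis B k
  have hle : Cardinal.mk T ≤ C := by
    by_contra! h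
    obtain ⟨S, hS⟩ := Cardinal.exists_finset_le_card T (C + 1) (by
      rw [Nat.cast_add_one, ← Cardinal.succ_natCast]
      exact Order.succ_le_of_lt h)
    have := hC S.card (fun i => ((S.equivFin.symm i : T) : k))
      (hT.1.comp (fun i => (S.equivFin.symm i : T))
        (Subtype.val_injective.comp S.equivFin.symm.injective))
    omega
  have hfin : Finite T := by
    rw [← Cardinal.lt_aleph0_iff_finite]
    exact hle.trans_lt Cardinal.natCast_lt_aleph0
  refine ⟨Nat.card T, fun i => ((Finite.equivFin T).symm i : T),
    hT.1.comp _ (Finite.equivFin T).symm.injective, ?_⟩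
  rw [← hT.cardinalMk_eq_trdeg, Nat.cast_card]

theorem exists_max_ratIndep {Γ₀ : Type*} [LinearOrderedCommGroupWithZero Γ₀] (v : Valuation L Γ₀)
    (C : ℕ) (hC : ∀ (r : ℕ) (x : Fin r → L), RatIndep v x → r ≤ C) :
    ∃ (r : ℕ) (x : Fin r → L), RatIndep v x ∧
      ∀ (m : ℕ) (z : Fin m → L), RatIndep v z → m ≤ r := by
  classical
  let P : ℕ → Prop := fun r => ∃ x : Fin r → L, RatIndep v x
  have h0 : P 0 := ⟨Fin.elim0, fun i => i.elim0, fun e _ => Subsingleton.elim _ _⟩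
  obtain ⟨x, hx⟩ := Nat.findGreatest_spec (P := P) (Nat.zero_le C) h0
  exact ⟨_, x, hx, fun m z hz => Nat.le_findGreatest (hC m z hz) ⟨z, hz⟩⟩

/-- Abhyankar's inequality for a valuation of a field `L` of transcendence degree at most `s` over a
Noetherian domain `A`, and finite generation of the value group and of the residue field in the case
of equality. Induction on the height `n` of the center: unless the counting argument applies to `V`,
it applies to the valuation induced by `V` on the residue field of the ring `V₁` obtained by
inverting an element of largest value in the center, and the center of `V₁` has smaller height. -/
theorem abhyankar [IsDomain A] [IsNoetherianRing A] [FaithfulSMul A L] {s : ℕ}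
    (hs : Algebra.trdeg A L ≤ s) (n : ℕ) : ∀ (V : ValuationSubring L)
      (hA : ∀ a : A, V.valuation (algebraMap A L a) ≤ 1),
      (centerIdeal V.valuation hA).height = n →
      (∀ (r t : ℕ) (x : Fin r → L) (y : Fin t → L), RatIndep V.valuation x →
        ResIndep A V.valuation y → r + t ≤ n + s) ∧
      (FracFG A L → ∀ (r t : ℕ) (x : Fin r → L) (y : Fin t → L), RatIndep V.valuation x →
        ResIndep A V.valuation y → r + t = n + s → ValFG V.valuation ∧ ResFG A V.valuation) := by
  induction n using Nat.strong_induction_on with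
  | _ n ih =>
  intro V hA hn
  obtain ⟨f, hf, hmax⟩ := exists_maximal_center hA
  by_cases hf0 : f = 0
  · -- The center is zero, and the powers of `f` have arbitrarily small values for trivial reasons.
    have hcof : ∀ l : L, ∃ k, V.valuation (algebraMap A L f ^ k * l) < 1 := fun l =>
      ⟨1, by simp [hf0]⟩
    refine ⟨fun r t x y hx hy => ?_, fun hfg r t x y hx hy heq => ⟨?_, ?_⟩⟩
    · simpa using card_add_card_le_of_cofinal hA hs hn hf hmax hcof hx hy
    · exact valFG_of_cofinal hA hs hn hf hmax hcof hfg hx hy (by simpa using heq)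
    · exact resFG_of_cofinal hA hs hn hf hmax hcof hfg hx hy (by simpa using heq)
  have hfL : algebraMap A L f ≠ 0 := by
    rwa [Ne, FaithfulSMul.algebraMap_eq_zero_iff]
  set V₁ := invertSubring V (algebraMap A L f) (hA f)
  have hV : V ≤ V₁ := le_invertSubring
  have hA₁ : ∀ a : A, V₁.valuation (algebraMap A L a) ≤ 1 := fun a =>
    valuation_le_one_of_le hV (hA a)
  have hA₁' : ∀ a : A, algebraMap A L a ∈ V₁ := fun a => (V₁.valuation_le_one_iff _).1 (hA₁ a)
  set p := centerIdeal V.valuation hA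
  set p₁ := centerIdeal V₁.valuation hA₁
  have hlt : p₁ < p := by
    refine lt_of_le_of_ne (fun a ha => valuation_lt_one_of_le hV ha) fun h => ?_
    have : f ∈ p₁ := h ▸ hf
    rw [mem_centerIdeal, valuation_invertSubring hfL] at this
    exact lt_irrefl _ this
  -- the image of `A` in the residue field of `V₁`
  let φ : A →+* IsLocalRing.ResidueField V₁ :=
    (IsLocalRing.residue V₁).comp ((algebraMap A L).codRestrict V₁ hA₁')
  have hφ : ∀ a, φ a = IsLocalRing.residue V₁ ⟨algebraMap A L a, hA₁' a⟩ := fun a => rfl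
  have hφ0 : ∀ a, φ a = 0 ↔ a ∈ p₁ := fun a => by
    rw [hφ, IsLocalRing.residue_eq_zero_iff, ValuationSubring.valuation_lt_one_iff]
    rfl
  let _ : Algebra (A ⧸ p₁) (IsLocalRing.ResidueField V₁) :=
    (Ideal.Quotient.lift p₁ φ fun a ha => (hφ0 a).2 ha).toAlgebra
  have hcomm : ∀ a : A, algebraMap (A ⧸ p₁) (IsLocalRing.ResidueField V₁) (Ideal.Quotient.mk p₁ a) =
      IsLocalRing.residue V₁ ⟨algebraMap A L a, hA₁' a⟩ := fun a => rfl
  have hinj : Function.Injective (algebraMap (A ⧸ p₁) (IsLocalRing.ResidueField V₁)) := by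
    rw [injective_iff_map_eq_zero]
    intro a ha
    obtain ⟨a, rfl⟩ := Ideal.Quotient.mk_surjective a
    rw [Ideal.Quotient.eq_zero_iff_mem, ← hφ0]
    exact ha
  have : FaithfulSMul (A ⧸ p₁) (IsLocalRing.ResidueField V₁) :=
    (faithfulSMul_iff_algebraMap_injective _ _).2 hinj
  have hπ : Function.Surjective (Ideal.Quotient.mk p₁) := Ideal.Quotient.mk_surjective
  -- heights
  obtain ⟨d₁, hd₁⟩ := ENat.ne_top_iff_exists.1 (Ideal.height_ne_top (I := p₁) Ideal.IsPrime.ne_top')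
  have hA₂ : ∀ a : A ⧸ p₁, residueValuation hV (algebraMap (A ⧸ p₁) _ a) ≤ 1 := fun a => by
    obtain ⟨a, rfl⟩ := hπ a
    rw [hcomm, residueValuation_le_one_iff]
    exact hA a
  set p₂ := centerIdeal (residueValuation hV) hA₂
  have hp₂ : p₂.comap (Ideal.Quotient.mk p₁) = p := by
    ext a
    rw [Ideal.mem_comap, mem_centerIdeal, hcomm, residueValuation_lt_one_iff]
    rfl
  obtain ⟨d₂, hd₂⟩ := ENat.ne_top_iff_exists.1 (Ideal.height_ne_top (I := p₂) Ideal.IsPrime.ne_top')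
  have hd : d₁ + d₂ ≤ n := by
    have := add_height_le_height_comap hπ p₁ (by rw [Ideal.mk_ker]) d₂ p₂ inferInstance hd₂.le
    rw [hp₂, hn, ← hd₁] at this
    have h2 : d₂ + d₁ ≤ n := by exact_mod_cast this
    omega
  have hd₁n : d₁ < n := by
    have := Ideal.height_add_one_le_of_lt_of_isPrime hlt
    rw [hn, ← hd₁] at this
    have h2 : d₁ + 1 ≤ n := by exact_mod_cast this
    omega
  obtain ⟨ih₁, ih₂⟩ := ih d₁ hd₁n V₁ hA₁ hd₁.symm
  have hemptyVal : RatIndep V₁.valuation (Fin.elim0 : Fin 0 → L) :=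
    ⟨fun i => i.elim0, fun e _ => Subsingleton.elim _ _⟩
  -- a transcendence basis of the residue field of `V₁`, and its lift to `V₁`
  have hlift : ∀ (m : ℕ) (y : Fin m → IsLocalRing.ResidueField V₁),
      AlgebraicIndependent (A ⧸ p₁) y → ∃ z : Fin m → L, ResIndep A V₁.valuation z := by
    intro m y hy
    choose z hz using fun i => IsLocalRing.residue_surjective (y i)
    refine ⟨fun i => (z i : L), resIndep_of_algebraicIndependent hA₁' hcomm ?_⟩
    simpa only [hz] using hy
  obtain ⟨t₁, y₁, hy₁, ht₁⟩ := exists_finite_transcendenceBasis (B := A ⧸ p₁)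
    (k := IsLocalRing.ResidueField V₁) (d₁ + s) (fun m y hy => by
      obtain ⟨z, hz⟩ := hlift m y hy
      simpa using ih₁ 0 m Fin.elim0 z hemptyVal hz)
  obtain ⟨z₁, hz₁⟩ := hlift t₁ y₁ hy₁
  obtain ⟨r₁, x₁, hx₁, hr₁⟩ := exists_max_ratIndep V₁.valuation (d₁ + s) (fun m x hx => by
    have := ih₁ m t₁ x z₁ hx hz₁
    omega)
  have hrt₁ := ih₁ r₁ t₁ x₁ z₁ hx₁ hz₁
  -- the valuation of the residue field of `V₁`
  have hf₂ : residueValuation hV (algebraMap (A ⧸ p₁) _ (Ideal.Quotient.mk p₁ f)) < 1 := by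
    rw [hcomm, residueValuation_lt_one_iff]
    exact hf
  have hmax₂ : ∀ a ∈ p₂, residueValuation hV (algebraMap (A ⧸ p₁) _ a) ≤
      residueValuation hV (algebraMap (A ⧸ p₁) _ (Ideal.Quotient.mk p₁ f)) := by
    intro a ha
    obtain ⟨a, rfl⟩ := hπ a
    have hap : a ∈ p := by rw [← hp₂]; exact ha
    have hq : V.valuation (algebraMap A L a / algebraMap A L f) ≤ 1 := by
      rw [map_div₀]
      exact div_le_one_of_le₀ (hmax a hap) zero_le
    let q : V₁ := ⟨_, hV ((V.valuation_le_one_iff _).1 hq)⟩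
    have hmul : IsLocalRing.residue V₁ ⟨algebraMap A L a, hA₁' a⟩ =
        IsLocalRing.residue V₁ q * IsLocalRing.residue V₁ ⟨algebraMap A L f, hA₁' f⟩ := by
      rw [← map_mul]
      congr 1
      exact Subtype.ext (div_mul_cancel₀ _ hfL).symm
    rw [hcomm, hcomm, hmul, map_mul]
    exact mul_le_of_le_one_left' ((residueValuation_le_one_iff hV).2 hq)
  have hcof₂ : ∀ c : IsLocalRing.ResidueField V₁, ∃ k,
      residueValuation hV (algebraMap (A ⧸ p₁) _ (Ideal.Quotient.mk p₁ f) ^ k * c) < 1 := by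
    intro c
    obtain ⟨l, rfl⟩ := IsLocalRing.residue_surjective c
    obtain ⟨k, hk⟩ := mem_invertSubring.1 l.2
    refine ⟨k + 1, ?_⟩
    rw [hcomm, ← map_pow, ← map_mul, residueValuation_lt_one_iff]
    change V.valuation (algebraMap A L f ^ (k + 1) * (l : L)) < 1
    rw [pow_succ', mul_assoc, map_mul]
    exact lt_of_le_of_lt (mul_le_of_le_one_right' hk) hf
  -- lifts of elements of `V` to `V₁`
  have hres : ∀ {t : ℕ} {y : Fin t → L}, ResIndep A V.valuation y →
      ∃ w : Fin t → IsLocalRing.ResidueField V₁, ResIndep (A ⧸ p₁) (residueValuation hV) w :=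
    fun {t y} hy => ⟨_, resIndep_residue hV hπ hA₁' hcomm
      (y := fun i => ⟨y i, hV ((V.valuation_le_one_iff _).1 (hy.1 i))⟩) hy⟩
  have hbound : ∀ {t m : ℕ} {w : Fin t → IsLocalRing.ResidueField V₁}
      {z : Fin m → IsLocalRing.ResidueField V₁}, RatIndep (residueValuation hV) z →
      ResIndep (A ⧸ p₁) (residueValuation hV) w → m + t ≤ d₂ + t₁ := fun hz hw => by
    simpa using card_add_card_le_of_cofinal hA₂ ht₁.le hd₂.symm hf₂ hmax₂ hcof₂ hz hw
  have hempty : ResIndep (A ⧸ p₁) (residueValuation hV)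
      (Fin.elim0 : Fin 0 → IsLocalRing.ResidueField V₁) := by
    refine ⟨fun i => i.elim0, fun P hP m => ?_⟩
    obtain ⟨a, rfl⟩ := MvPolynomial.C_surjective (Fin 0) P
    rw [MvPolynomial.aeval_C] at hP
    rw [Subsingleton.elim m 0, MvPolynomial.coeff_zero_C]
    exact hP
  obtain ⟨r₂, x₂, hx₂, hr₂⟩ := exists_max_ratIndep (residueValuation hV) (d₂ + t₁)
    (fun m x hx => hbound hx hempty)
  have hrank : ∀ {r : ℕ} {x : Fin r → L}, RatIndep V.valuation x → r ≤ r₁ + r₂ := fun hx => by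
    simpa using card_le_add_of_composite hV hr₁ hr₂ hx
  refine ⟨fun r t x y hx hy => ?_, fun hfg r t x y hx hy heq => ?_⟩
  · obtain ⟨w, hw⟩ := hres hy
    have h1 := hbound hx₂ hw
    have h2 := hrank hx
    omega
  · obtain ⟨w, hw⟩ := hres hy
    have h1 := hbound hx₂ hw
    have h2 := hrank hx
    -- equality for `V` forces equality for both constituents
    obtain ⟨hv₁, hf₁⟩ := ih₂ hfg r₁ t₁ x₁ z₁ hx₁ hz₁ (by omega)
    have hfg₂ := fracFG_residueField hA₁' hcomm hf₁
    have heq₂ : Fintype.card (Fin r₂) + Fintype.card (Fin t) = d₂ + t₁ := by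
      rw [Fintype.card_fin, Fintype.card_fin]; omega
    exact ⟨valFG_of_composite hV hv₁
        (valFG_of_cofinal hA₂ ht₁.le hd₂.symm hf₂ hmax₂ hcof₂ hfg₂ hx₂ hw heq₂),
      resFG_of_composite hV hπ hA₁' hcomm
        (resFG_of_cofinal hA₂ ht₁.le hd₂.symm hf₂ hmax₂ hcof₂ hfg₂ hx₂ hw heq₂)⟩

end Abhyankar

/-! ### The degree of a field over its subfield of `p`-th powers -/

section FrobeniusDegree

variable {p : ℕ} [Fact p.Prime]

section

variable {L : Type*} [Field L] [CharP L p]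

/-- Linear independence over the `p`-th powers, with the coefficients written as `p`-th powers. -/
theorem linearIndependent_frobeniusSubfield_iff {ι : Type*} [Fintype ι] {e : ι → L} :
    LinearIndependent (frobeniusSubfield p L) e ↔
      ∀ c : ι → L, ∑ i, c i ^ p * e i = 0 → c = 0 := by
  have hp : p ≠ 0 := (Fact.out : p.Prime).ne_zero
  rw [Fintype.linearIndependent_iff]
  constructor
  · intro h c hc
    have := h (fun i => ⟨c i ^ p, (mem_frobeniusSubfield_iff p L _).2 ⟨c i, rfl⟩⟩)
      (by simpa [Subfield.smul_def] using hc)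
    ext i
    exact pow_eq_zero_iff hp |>.1 (congrArg Subtype.val (this i))
  · intro h c hc i
    choose a ha using fun i => (mem_frobeniusSubfield_iff p L _).1 (c i).2
    have := h a (by simpa [ha, Subfield.smul_def] using hc)
    refine Subtype.ext ?_
    rw [← ha, congrFun this i]
    simp [hp]

omit [Fact p.Prime] [CharP L p] in
theorem frobeniusDegree_eq_of_finrank {n : ℕ} (hn : n ≠ 0)
    (h : Module.finrank (frobeniusSubfield p L) L = n) : frobeniusDegree p L = n := by
  have : Module.Finite (frobeniusSubfield p L) L := Module.finite_of_finrank_pos (by omega)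
  rw [frobeniusDegree, ← Module.finrank_eq_rank, h]
  simp

omit [Fact p.Prime] [CharP L p] in
theorem exists_finrank_of_frobeniusDegree (h : frobeniusDegree p L < ⊤) :
    ∃ n : ℕ, n ≠ 0 ∧ Module.finrank (frobeniusSubfield p L) L = n ∧ frobeniusDegree p L = n := by
  have h1 : Module.rank (frobeniusSubfield p L) L < Cardinal.aleph0 := by
    rw [frobeniusDegree] at h
    exact Cardinal.toENat_lt_top.1 h
  have : Module.Finite (frobeniusSubfield p L) L := Module.rank_lt_aleph0_iff.1 h1
  have h2 : Module.finrank (frobeniusSubfield p L) L ≠ 0 := Module.finrank_pos.ne'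
  exact ⟨_, h2, rfl, frobeniusDegree_eq_of_finrank h2 rfl⟩

theorem sum_pow_mul_mem_span {ι : Type*} [Fintype ι] (e : ι → L) (c : ι → L) :
    ∑ i, c i ^ p * e i ∈ Submodule.span (frobeniusSubfield p L) (Set.range e) :=
  Submodule.sum_mem _ fun i _ => Submodule.smul_mem _
    (⟨c i ^ p, (mem_frobeniusSubfield_iff p L _).2 ⟨c i, rfl⟩⟩ : frobeniusSubfield p L)
    (Submodule.subset_span ⟨i, rfl⟩)

end

/-- The Frobenius, as an isomorphism of a field with its subfield of `p`-th powers. -/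
def equivFrobeniusSubfield (p : ℕ) [Fact p.Prime] (L : Type*) [Field L] [CharP L p] :
    L ≃+* frobeniusSubfield p L :=
  RingEquiv.ofBijective ((frobenius L p).codRestrict (frobeniusSubfield p L)
    fun a => (mem_frobeniusSubfield_iff p L _).2 ⟨a, rfl⟩)
    ⟨fun _ _ h => frobenius_inj L p (congrArg Subtype.val h), fun b => by
      obtain ⟨a, ha⟩ := (mem_frobeniusSubfield_iff p L _).1 b.2
      exact ⟨a, Subtype.ext ha⟩⟩

variable {k L : Type*} [Field k] [Field L] [Algebra k L] [CharP k p] [CharP L p]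

variable (p) in
/-- A finite extension does not change the degree over the `p`-th powers: one has
`[L : k] [k : k ^ p] = [L : L ^ p] [L ^ p : k ^ p]`, and `[L ^ p : k ^ p] = [L : k]` by means of the
Frobenius. -/
theorem finrank_frobeniusSubfield_eq [FiniteDimensional k L] :
    Module.finrank (frobeniusSubfield p k) k = Module.finrank (frobeniusSubfield p L) L := by
  have hmem : ∀ a : frobeniusSubfield p k, algebraMap k L a ∈ frobeniusSubfield p L := by
    rintro ⟨a, ha⟩
    obtain ⟨b, rfl⟩ := (mem_frobeniusSubfield_iff p k a).1 ha
    exact (mem_frobeniusSubfield_iff p L _).2 ⟨algebraMap k L b, (map_pow _ _ _).symm⟩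
  let j : frobeniusSubfield p k →+* frobeniusSubfield p L :=
    ((algebraMap k L).comp (frobeniusSubfield p k).subtype).codRestrict _ hmem
  let _ : Algebra (frobeniusSubfield p k) (frobeniusSubfield p L) := j.toAlgebra
  have : IsScalarTower (frobeniusSubfield p k) (frobeniusSubfield p L) L :=
    IsScalarTower.of_algebraMap_eq fun _ => rfl
  have h1 := Module.finrank_mul_finrank (frobeniusSubfield p k) k L
  have h2 := Module.finrank_mul_finrank (frobeniusSubfield p k) (frobeniusSubfield p L) L
  have h3 : Module.finrank (frobeniusSubfield p k) (frobeniusSubfield p L) =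
      Module.finrank k L := by
    refine (Algebra.finrank_eq_of_equiv_equiv (equivFrobeniusSubfield p k)
      (equivFrobeniusSubfield p L) ?_).symm
    ext a
    exact map_pow (algebraMap k L) a p
  rw [h3, ← h1, mul_comm] at h2
  exact (Nat.eq_of_mul_eq_mul_right Module.finrank_pos
    (h2.trans rfl)).symm

/-- Finitely many elements of an algebraic extension that are independent over `L ^ p` lie in a
finite extension of `k`, and there they are independent over the `p`-th powers as well. -/
theorem frobeniusDegree_le_of_isAlgebraic [Algebra.IsAlgebraic k L] {n : ℕ} (hn : n ≠ 0)
    (h : Module.finrank (frobeniusSubfield p k) k = n) : frobeniusDegree p L ≤ n := by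
  have key : Module.rank (frobeniusSubfield p L) L ≤ n := by
    refine rank_le fun s hs => ?_
    let E := IntermediateField.adjoin k (s : Set L)
    have : FiniteDimensional k E := IntermediateField.finiteDimensional_adjoin fun x _ =>
      (Algebra.IsAlgebraic.isAlgebraic x).isIntegral
    have : CharP E p := charP_of_injective_algebraMap (algebraMap k E).injective p
    have h1 : Module.finrank (frobeniusSubfield p E) E = n := by
      rw [← h, finrank_frobeniusSubfield_eq (L := E) p (k := k)]
    have : Module.Finite (frobeniusSubfield p E) E := Module.finite_of_finrank_pos (by omega)
    let e : s → E := fun i => ⟨i, IntermediateField.subset_adjoin k _ i.2⟩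
    have hli : LinearIndependent (frobeniusSubfield p E) e := by
      rw [linearIndependent_frobeniusSubfield_iff] at hs ⊢
      intro c hc
      have := hs (fun i => (c i : L)) (by
        have := congrArg (algebraMap E L) hc
        rw [map_sum, map_zero] at this
        simpa [e] using this)
      ext i
      exact congrFun this i
    have := hli.fintype_card_le_finrank
    rwa [h1, Fintype.card_coe] at this
  rw [frobeniusDegree]
  simpa using Cardinal.toENat.monotone' key

/-- If `b i` is a basis of `k` over `k ^ p`, then the products of the `b i` with the monomials in
the `y j` with exponents less than `p` are a basis of `k(y)` over its `p`-th powers. -/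
theorem finrank_frobeniusSubfield_of_algebraicIndependent {t : ℕ} {y : Fin t → L}
    (hy : AlgebraicIndependent k y) (htop : IntermediateField.adjoin k (Set.range y) = ⊤) {n : ℕ}
    (hn : n ≠ 0) (h : Module.finrank (frobeniusSubfield p k) k = n) :
    Module.finrank (frobeniusSubfield p L) L = p ^ t * n := by
  have hp : p.Prime := Fact.out
  have : Module.Finite (frobeniusSubfield p k) k := Module.finite_of_finrank_pos (by omega)
  let b := Module.finBasisOfFinrankEq (frobeniusSubfield p k) k h
  let e : Fin n × (Fin t → Fin p) → L := fun q => algebraMap k L (b q.1) * ∏ j, y j ^ (q.2 j : ℕ)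
  have hfrac : ∀ x : L, ∃ r s : MvPolynomial (Fin t) k,
      x = MvPolynomial.aeval y r / MvPolynomial.aeval y s := fun x => by
    rw [← IntermediateField.mem_adjoin_range_iff, htop]
    exact IntermediateField.mem_top
  have hspan : ⊤ ≤ Submodule.span (frobeniusSubfield p L) (Set.range e) := by
    have hmon : ∀ (a : k) (m : Fin t →₀ ℕ), algebraMap k L a * ∏ j, y j ^ m j ∈
        Submodule.span (frobeniusSubfield p L) (Set.range e) := by
      intro a m
      choose α hα using fun i => (mem_frobeniusSubfield_iff p k _).1 (b.repr a i).2
      have ha : a = ∑ i, α i ^ p * b i := by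
        conv_lhs => rw [← b.sum_repr a]
        exact Finset.sum_congr rfl fun i _ => by rw [hα, Subfield.smul_def, smul_eq_mul]
      have hm : ∏ j, y j ^ m j = (∏ j, y j ^ (m j / p)) ^ p * ∏ j, y j ^ (m j % p) := by
        rw [← Finset.prod_pow, ← Finset.prod_mul_distrib]
        refine Finset.prod_congr rfl fun j _ => ?_
        rw [← pow_mul, ← pow_add, Nat.div_add_mod']
      have := sum_pow_mul_mem_span (p := p)
        (fun i => e (i, fun j => ⟨m j % p, Nat.mod_lt _ hp.pos⟩))
        (fun i => algebraMap k L (α i) * ∏ j, y j ^ (m j / p))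
      have h2 : ∑ i, (algebraMap k L (α i) * ∏ j, y j ^ (m j / p)) ^ p *
          e (i, fun j => ⟨m j % p, Nat.mod_lt _ hp.pos⟩) = algebraMap k L a * ∏ j, y j ^ m j := by
        rw [ha, hm, map_sum, Finset.sum_mul]
        refine Finset.sum_congr rfl fun i _ => ?_
        simp only [e, map_mul, map_pow]
        ring
      rw [h2] at this
      refine Submodule.span_mono ?_ this
      rintro _ ⟨i, rfl⟩
      exact ⟨_, rfl⟩
    have hpoly : ∀ P : MvPolynomial (Fin t) k, MvPolynomial.aeval y P ∈
        Submodule.span (frobeniusSubfield p L) (Set.range e) := by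
      intro P
      rw [MvPolynomial.aeval_def, MvPolynomial.eval₂_eq']
      exact Submodule.sum_mem _ fun m _ => hmon _ m
    intro x _
    obtain ⟨r, s, rfl⟩ := hfrac x
    -- clear the denominator with the `p`-th power of its inverse
    have h1 : MvPolynomial.aeval y r / MvPolynomial.aeval y s =
        ((MvPolynomial.aeval y s)⁻¹) ^ p * MvPolynomial.aeval y (r * s ^ (p - 1)) := by
      by_cases hs : MvPolynomial.aeval y s = 0
      · simp [hs, hp.ne_zero]
      · rw [map_mul, map_pow, inv_pow, div_eq_iff hs, inv_mul_eq_div, div_mul_eq_mul_div,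
          eq_div_iff (pow_ne_zero _ hs), mul_assoc, ← pow_succ, Nat.sub_add_cancel hp.one_le]
    rw [h1]
    exact Submodule.smul_mem _ (⟨_, (mem_frobeniusSubfield_iff p L _).2
      ⟨(MvPolynomial.aeval y s)⁻¹, rfl⟩⟩ : frobeniusSubfield p L) (hpoly _)
  have hli : LinearIndependent (frobeniusSubfield p L) e := by
    rw [linearIndependent_frobeniusSubfield_iff]
    intro c hc
    -- a common denominator of the coefficients
    have hden : ∃ (D : L) (G : Fin n × (Fin t → Fin p) → MvPolynomial (Fin t) k), D ≠ 0 ∧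
        ∀ q, c q * D = MvPolynomial.aeval y (G q) := by
      have h1 : ∀ q, ∃ r s : MvPolynomial (Fin t) k, MvPolynomial.aeval y s ≠ 0 ∧
          c q * MvPolynomial.aeval y s = MvPolynomial.aeval y r := by
        intro q
        obtain ⟨r, s, hrs⟩ := hfrac (c q)
        by_cases hs : MvPolynomial.aeval y s = 0
        · exact ⟨0, 1, by simp, by simp [hrs, hs]⟩
        · exact ⟨r, s, hs, by rw [hrs, div_mul_cancel₀ _ hs]⟩
      choose r s hs hrs using h1
      refine ⟨∏ q, MvPolynomial.aeval y (s q), fun q => r q * ∏ q' ∈ Finset.univ.erase q, s q',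
        Finset.prod_ne_zero_iff.2 fun q _ => hs q, fun q => ?_⟩
      rw [← Finset.mul_prod_erase _ _ (Finset.mem_univ q), ← mul_assoc, hrs, map_mul, map_prod]
    obtain ⟨D, G, hD, hG⟩ := hden
    have hQ : ∑ q, G q ^ p * MvPolynomial.monomial
        (Finsupp.equivFunOnFinite.symm fun j => (q.2 j : ℕ)) (b q.1) = 0 := by
      refine hy.eq_zero_of_aeval_eq_zero _ ?_
      have h2 : D ^ p * ∑ q, c q ^ p * e q = 0 := by rw [hc, mul_zero]
      rw [← h2, map_sum, Finset.mul_sum]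
      refine Finset.sum_congr rfl fun q _ => ?_
      rw [map_mul, map_pow, ← hG, MvPolynomial.aeval_monomial, Finsupp.prod_fintype _ _ (by simp)]
      simp only [e, Finsupp.equivFunOnFinite_symm_apply_apply]
      ring
    have hG0 : ∀ (i : Fin n) (ε : Fin t → Fin p) (δ : Fin t →₀ ℕ), (G (i, ε)).coeff δ = 0 := by
      intro i ε δ
      set ε' : (Fin t → Fin p) → (Fin t →₀ ℕ) := fun ε =>
        Finsupp.equivFunOnFinite.symm fun j => (ε j : ℕ)
      have hε' : ∀ η j, ε' η j = (η j : ℕ) := fun η j => rfl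
      -- compare the coefficients of the monomial with exponent `p δ + ε`
      have h3 := congrArg (MvPolynomial.coeff (p • δ + ε' ε)) hQ
      rw [MvPolynomial.coeff_sum, MvPolynomial.coeff_zero, Fintype.sum_prod_type] at h3
      have h4 : ∀ i' : Fin n, ∑ η : Fin t → Fin p, MvPolynomial.coeff (p • δ + ε' ε)
          (G (i', η) ^ p * MvPolynomial.monomial (ε' η) (b i')) =
            ((G (i', ε)).coeff δ) ^ p * b i' := by
        intro i'
        rw [Finset.sum_eq_single ε]
        · rw [MvPolynomial.coeff_mul_monomial, ← MvPolynomial.map_frobenius_expand,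
            MvPolynomial.coeff_map, MvPolynomial.coeff_expand_smul _ hp.ne_zero]
          rfl
        · intro η _ hη
          rw [MvPolynomial.coeff_mul_monomial']
          split_ifs with hle
          · obtain ⟨j, hj⟩ : ∃ j, η j ≠ ε j := by
              by_contra! hall
              exact hη (funext hall)
            rw [← MvPolynomial.map_frobenius_expand, MvPolynomial.coeff_map,
              MvPolynomial.coeff_expand_of_not_dvd (i := j), map_zero, zero_mul]
            have hlej := hle j
            rw [Finsupp.coe_tsub, Pi.sub_apply]
            simp only [Finsupp.add_apply, Finsupp.smul_apply, smul_eq_mul, hε'] at hlej ⊢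
            rintro ⟨u, hu⟩
            have h5 : (ε j : ℕ) ≡ (η j : ℕ) [MOD p] := by
              have h6 : p * δ j + (ε j : ℕ) = p * u + (η j : ℕ) := by omega
              have h7 := congrArg (· % p) h6
              simpa [Nat.ModEq, Nat.mul_add_mod] using h7
            refine hj (Fin.ext ?_)
            rw [Nat.ModEq, Nat.mod_eq_of_lt (ε j).2, Nat.mod_eq_of_lt (η j).2] at h5
            exact h5.symm
          · rfl
        · simp
      have h8 := (linearIndependent_frobeniusSubfield_iff (p := p)).1 b.linearIndependent
        (fun i' => (G (i', ε)).coeff δ) (by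
          rw [← h3]
          exact Finset.sum_congr rfl fun i' _ => (h4 i').symm)
      exact congrFun h8 i
    ext q
    have h9 : G q = 0 := MvPolynomial.ext _ _ fun δ => by
      rw [MvPolynomial.coeff_zero]; exact hG0 q.1 q.2 δ
    have h10 := hG q
    rw [h9, map_zero] at h10
    exact (mul_eq_zero.1 h10).resolve_right hD
  rw [Module.finrank_eq_card_basis (Module.Basis.mk hli hspan)]
  simp [mul_comm]

/-- The degree `[L : L ^ p]` is at most `p ^ t [k : k ^ p]` for an extension `L / k` of
transcendence degree `t`, with equality if `L / k` is finitely generated. -/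
theorem frobeniusDegree_le_and_eq {t : ℕ} {y : Fin t → L} (hy : IsTranscendenceBasis k y) {n : ℕ}
    (hn : n ≠ 0) (h : Module.finrank (frobeniusSubfield p k) k = n) :
    frobeniusDegree p L ≤ (p ^ t * n : ℕ) ∧
      (FracFG k L → frobeniusDegree p L = (p ^ t * n : ℕ)) := by
  have hp : p.Prime := Fact.out
  let E := IntermediateField.adjoin k (Set.range y)
  have : CharP E p := charP_of_injective_algebraMap (algebraMap k E).injective p
  let z : Fin t → E := fun i => ⟨y i, IntermediateField.subset_adjoin k _ ⟨i, rfl⟩⟩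
  have hz : AlgebraicIndependent k z :=
    (AlgHom.algebraicIndependent_iff E.val (x := z) Subtype.val_injective).1 hy.1
  have htop : IntermediateField.adjoin k (Set.range z) = ⊤ := by
    apply IntermediateField.lift_injective E
    rw [IntermediateField.lift_adjoin, IntermediateField.lift_top, ← Set.range_comp]
    rfl
  have hE := finrank_frobeniusSubfield_of_algebraicIndependent hz htop hn h
  have hne : p ^ t * n ≠ 0 := mul_ne_zero (pow_ne_zero _ hp.ne_zero) hn
  have halg : Algebra.IsAlgebraic E L := hy.isAlgebraic_field
  refine ⟨frobeniusDegree_le_of_isAlgebraic hne hE, fun ⟨F, hF⟩ => ?_⟩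
  have hfin : FiniteDimensional E L := by
    have htop' : IntermediateField.adjoin E (F : Set L) = ⊤ := by
      have hle : ∀ g ∈ Algebra.adjoin k (F : Set L), g ∈ IntermediateField.adjoin E (F : Set L) :=
        fun g hg => by
          have : Algebra.adjoin k (F : Set L) ≤
              (IntermediateField.adjoin E (F : Set L)).toSubalgebra.restrictScalars k :=
            Algebra.adjoin_le (IntermediateField.subset_adjoin E _)
          exact this hg
      rw [eq_top_iff]
      rintro a -
      obtain ⟨g, hg, u, hu, hu0, e⟩ := hF a
      rw [eq_div_of_mul_eq hu0 e]
      exact div_mem (hle g hg) (hle u hu)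
    have := IntermediateField.finiteDimensional_adjoin (K := E) (S := (F : Set L)) fun x _ =>
      (Algebra.IsAlgebraic.isAlgebraic x).isIntegral
    rw [htop'] at this
    exact Module.Finite.equiv (IntermediateField.topEquiv (F := E) (E := L)).toLinearEquiv
  exact frobeniusDegree_eq_of_finrank hne ((finrank_frobeniusSubfield_eq p).symm.trans hE)

end FrobeniusDegree

/-! ### The index of `pΓ` in a torsion-free abelian group -/

section MulIndex

variable {p : ℕ} {Γ : Type*} [AddCommGroup Γ]

theorem mulIndex_eq_card_modN : mulIndex p Γ = ENat.card (ModN Γ p) := by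
  have h : (nsmulAddMonoidHom (α := Γ) p).range =
      (LinearMap.range (LinearMap.lsmul ℤ Γ (p : ℤ))).toAddSubgroup := by
    ext x
    simp
  exact ENat.card_congr (QuotientAddGroup.quotientAddEquivOfEq h).toEquiv

variable [Fact p.Prime] [IsAddTorsionFree Γ]

/-- Elements of a torsion-free group that are independent modulo `p` are independent: all
coefficients of a linear relation are divisible by `p`, and the relation may be divided by `p`. -/
theorem linearIndependent_of_linearIndependent_modN {ι : Type*} [Fintype ι] {x : ι → Γ}
    (hx : LinearIndependent (ZMod p) fun i => ModN.mkQ p (x i)) : LinearIndependent ℤ x := by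
  have hp : p.Prime := Fact.out
  rw [Fintype.linearIndependent_iff] at hx ⊢
  have key : ∀ n : ℕ, ∀ e : ι → ℤ, ∑ i, e i • x i = 0 → ∀ i, (p : ℤ) ^ n ∣ e i := by
    intro n
    induction n with
    | zero => simp
    | succ n ih =>
      intro e he
      have h1 : ∀ i, (p : ℤ) ∣ e i := fun i => by
        have h2 := hx (fun i => (e i : ZMod p)) (by
          rw [← map_zero (ModN.mkQ p), ← he, map_sum]
          refine Finset.sum_congr rfl fun i _ => ?_
          rw [map_zsmul, Int.cast_smul_eq_zsmul]) i
        exact (ZMod.intCast_zmod_eq_zero_iff_dvd _ _).1 h2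
      choose f hf using h1
      have h3 : ∑ i, f i • x i = 0 := by
        have h4 : p • ∑ i, f i • x i = p • (0 : Γ) := by
          rw [smul_zero, ← he, Finset.smul_sum]
          refine Finset.sum_congr rfl fun i _ => ?_
          rw [hf, mul_smul, natCast_zsmul]
        exact nsmul_right_injective hp.ne_zero h4
      intro i
      rw [hf, pow_succ']
      exact mul_dvd_mul_left _ (ih f h3 i)
  intro e he i
  refine Int.eq_zero_of_abs_lt_dvd (key (e i).natAbs e he i) ?_
  rw [Int.abs_eq_natAbs]
  exact_mod_cast Nat.lt_pow_self hp.one_lt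

theorem mulIndex_le {r : ℕ} (h : Module.rank ℤ Γ ≤ r) : mulIndex p Γ ≤ (p ^ r : ℕ) := by
  have h1 : Module.rank (ZMod p) (ModN Γ p) ≤ r := by
    refine rank_le fun s hs => ?_
    have hsurj : Function.Surjective (ModN.mkQ p : Γ → ModN Γ p) := Submodule.mkQ_surjective _
    choose x hx using fun i : s => hsurj i
    have h2 : LinearIndependent ℤ x := by
      refine linearIndependent_of_linearIndependent_modN (p := p) ?_
      simpa only [hx] using hs
    have h3 := h2.cardinal_lift_le_rank.trans (Cardinal.lift_le.2 h)
    simpa using h3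
  have hfin : Module.Finite (ZMod p) (ModN Γ p) :=
    Module.rank_lt_aleph0_iff.1 (h1.trans_lt (Cardinal.natCast_lt_aleph0))
  have : Finite (ModN Γ p) := Module.finite_of_finite (ZMod p)
  rw [mulIndex_eq_card_modN, ENat.card_eq_coe_natCard,
    Module.natCard_eq_pow_finrank (K := ZMod p), Nat.card_zmod]
  have h4 : Module.finrank (ZMod p) (ModN Γ p) ≤ r := Module.finrank_le_of_rank_le h1
  exact_mod_cast Nat.pow_le_pow_right (Nat.Prime.pos Fact.out) h4

theorem mulIndex_eq_of_finite [Module.Finite ℤ Γ] :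
    mulIndex p Γ = (p ^ Module.finrank ℤ Γ : ℕ) := by
  have : Module.Free ℤ Γ := inferInstance
  rw [mulIndex_eq_card_modN, ENat.card_eq_coe_natCard, ModN.natCard_eq]

theorem rationalRank_eq (Γ : Type*) [AddCommGroup Γ] :
    rationalRank Γ = Cardinal.toENat (Module.rank ℤ Γ) := by
  have h := IsLocalizedModule.rank_eq (nonZeroDivisors ℤ) le_rfl (TensorProduct.mk ℤ ℚ Γ 1)
  rw [rationalRank, IsLocalization.rank_eq ℚ (nonZeroDivisors ℤ) le_rfl, ← h]
  congr!

end MulIndex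

/-! ### Valuations centered on a Noetherian local domain -/

section ValueGroup

variable {K : Type*} [Field K] {Γ₀ : Type*} [LinearOrderedCommGroupWithZero Γ₀]

theorem RatIndep.congr {Γ₀' : Type*} [LinearOrderedCommGroupWithZero Γ₀'] {v : Valuation K Γ₀}
    {v' : Valuation K Γ₀'} (h : v.IsEquiv v') {ι : Type*} [Fintype ι] {x : ι → K}
    (hx : RatIndep v x) : RatIndep v' x :=
  ⟨hx.1, fun e he => hx.2 e (h.eq_one_iff_eq_one.2 he)⟩

variable (ν : Valuation K Γ₀)

/-- The valuation, as a homomorphism from `Kˣ` onto the (multiplicative) value group. -/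
def unitValue : Kˣ →* MonoidWithZeroHom.valueGroup (.ofClass ν : K →*₀ Γ₀) :=
  (Units.map (ν : K →* Γ₀)).codRestrict _ fun l => (mem_valueGroup_iff ν _).2 ⟨l, l.ne_zero, rfl⟩

theorem unitValue_surjective : Function.Surjective (unitValue ν) := by
  rintro ⟨g, hg⟩
  obtain ⟨l, hl, h⟩ := (mem_valueGroup_iff ν g).1 hg
  exact ⟨Units.mk0 l hl, Subtype.ext (Units.ext h)⟩

variable {ν}

theorem linearIndependent_unitValue_iff {ι : Type*} [Fintype ι] {x : ι → Kˣ} :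
    LinearIndependent ℤ (fun i => (Additive.ofMul (unitValue ν (x i)) : ValueGroup ν)) ↔
      RatIndep ν fun i => (x i : K) := by
  rw [← linearIndependent_valClass_iff]
  let f : ValueGroup ν →ₗ[ℤ] Additive Γ₀ˣ :=
    (MonoidHom.toAdditive (Subgroup.subtype _)).toIntLinearMap
  have hf : LinearMap.ker f = ⊥ := LinearMap.ker_eq_bot.2 Subtype.val_injective
  exact (f.linearIndependent_iff hf).symm

theorem finite_valueGroup (h : ValFG ν) : Module.Finite ℤ (ValueGroup ν) := by
  obtain ⟨S, hS, h⟩ := h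
  rw [Module.Finite.iff_addGroup_fg, ← GroupFG.iff_add_fg, Group.fg_iff]
  refine ⟨unitValue ν '' S, ?_, hS.image _⟩
  rw [← MonoidHom.map_closure, eq_top_iff]
  rintro g -
  obtain ⟨l, rfl⟩ := unitValue_surjective ν g
  obtain ⟨u, hu, e⟩ := h l
  exact ⟨u, hu, Subtype.ext (Units.ext e.symm)⟩

theorem rank_valueGroup_eq {r : ℕ} {x : Fin r → K} (hx : RatIndep ν x)
    (hmax : ∀ (m : ℕ) (z : Fin m → K), RatIndep ν z → m ≤ r) :
    Module.rank ℤ (ValueGroup ν) = r := by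
  apply le_antisymm
  · refine rank_le fun s hs => ?_
    choose l hl using fun g : ValueGroup ν => unitValue_surjective ν (Additive.toMul g)
    let f : Fin s.card → s := s.equivFin.symm
    refine hmax s.card (fun i => l (f i)) ?_
    rw [← linearIndependent_unitValue_iff]
    simp only [hl]
    exact hs.comp f s.equivFin.symm.injective
  · have h : LinearIndependent ℤ fun i =>
        (Additive.ofMul (unitValue ν (Units.mk0 (x i) (hx.1 i))) : ValueGroup ν) :=
      linearIndependent_unitValue_iff.2 hx
    simpa using h.cardinal_lift_le_rank

end ValueGroup

section Center

variable {K : Type*} [Field K] {Γ₀ : Type*} [LinearOrderedCommGroupWithZero Γ₀]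
  {ν : Valuation K Γ₀} {R : Type*} [CommRing R] [IsDomain R] [IsLocalRing R] [IsNoetherianRing R]
  [Algebra R K] [IsFractionRing R K]

/-- The inequality of Abhyankar for a valuation centered on `R`, and the finiteness statements in
the case of equality. -/
theorem IsCenteredOn.abhyankar (hν : IsCenteredOn ν R)
    [Algebra (IsLocalRing.ResidueField R) (ResidueField ν)]
    (halg : algebraMap (IsLocalRing.ResidueField R) (ResidueField ν) = hν.residueFieldMap) :
    ∃ (d r t : ℕ) (y : Fin t → ResidueField ν), ringKrullDim R = d ∧
      Module.rank ℤ (ValueGroup ν) = r ∧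
      Algebra.trdeg (IsLocalRing.ResidueField R) (ResidueField ν) = t ∧
      IsTranscendenceBasis (IsLocalRing.ResidueField R) y ∧ r + t ≤ d ∧
      (r + t = d → Module.Finite ℤ (ValueGroup ν) ∧
        FracFG (IsLocalRing.ResidueField R) (ResidueField ν)) := by
  let V := ν.valuationSubring
  have hequiv : ν.IsEquiv V.valuation := ν.isEquiv_valuation_valuationSubring
  have hA : ∀ a : R, V.valuation (algebraMap R K a) ≤ 1 := fun a =>
    (V.valuation_le_one_iff _).2 (hν.le_valuationRing a)
  have hcomm : ∀ a : R, algebraMap (IsLocalRing.ResidueField R) (ResidueField ν)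
      (IsLocalRing.residue R a) = IsLocalRing.residue V ⟨algebraMap R K a, hν.le_valuationRing a⟩ :=
    fun a => by rw [halg]; rfl
  have hcenter : centerIdeal V.valuation hA = IsLocalRing.maximalIdeal R := by
    ext a
    rw [← hν.comap_maximalIdeal, mem_centerIdeal, Ideal.mem_comap]
    exact (V.valuation_lt_one_iff ⟨_, hν.le_valuationRing a⟩).symm
  obtain ⟨d, hd⟩ := ENat.ne_top_iff_exists.1
    (Ideal.height_ne_top (I := IsLocalRing.maximalIdeal R) (Ideal.IsPrime.ne_top'))
  have hdim : ringKrullDim R = d := by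
    rw [← IsLocalRing.maximalIdeal_height_eq_ringKrullDim, ← hd]; rfl
  have : Algebra.IsAlgebraic R K := (IsFractionRing.comap_isAlgebraic_iff (K := K)).2 inferInstance
  obtain ⟨hle, heq⟩ := AbhyankarCenter.abhyankar (A := R) (L := K) (s := 0)
    (by rw [trdeg_eq_zero, Nat.cast_zero]) d V hA (by rw [hcenter, hd])
  have hfrac : FracFG R K := ⟨∅, fun a => by
    obtain ⟨g, h, hh, e⟩ := IsFractionRing.div_surjective (A := R) a
    have hh0 : algebraMap R K h ≠ 0 := IsFractionRing.to_map_ne_zero_of_mem_nonZeroDivisors hh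
    exact ⟨_, algebraMap_mem _ g, _, algebraMap_mem _ h, hh0, by rw [← e, div_mul_cancel₀ _ hh0]⟩⟩
  have hres : ∀ {t : ℕ} {y : Fin t → ResidueField ν},
      AlgebraicIndependent (IsLocalRing.ResidueField R) y →
      ∃ y' : Fin t → K, ResIndep R V.valuation y' := fun {t y} hy => by
    choose y' hy' using fun i => IsLocalRing.residue_surjective (R := V) (y i)
    obtain rfl : (fun i => IsLocalRing.residue V (y' i)) = y := funext hy'
    exact ⟨_, resIndep_of_algebraicIndependent hν.le_valuationRing hcomm hy⟩
  have hempty : RatIndep V.valuation (Fin.elim0 : Fin 0 → K) :=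
    ⟨fun i => i.elim0, fun e _ => Subsingleton.elim _ _⟩
  obtain ⟨t, y, hy, ht⟩ := exists_finite_transcendenceBasis (B := IsLocalRing.ResidueField R)
    (k := ResidueField ν) d fun m y hy => by
      obtain ⟨y', hy'⟩ := hres hy
      simpa using hle 0 m _ y' hempty hy'
  obtain ⟨y', hy'⟩ := hres hy
  obtain ⟨r, x, hx, hmax⟩ := exists_max_ratIndep ν d fun r x hx => by
    have := hle r t x y' (hx.congr hequiv) hy'
    omega
  refine ⟨d, r, t, y, hdim, rank_valueGroup_eq hx hmax, ht,
    hy.isTranscendenceBasis_of_lift_trdeg_le_of_finite (by simp [ht]),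
    hle r t x y' (hx.congr hequiv) hy', fun h => ?_⟩
  obtain ⟨⟨S, hS, h1⟩, h2⟩ := heq hfrac r t x y' (hx.congr hequiv) hy' h
  refine ⟨finite_valueGroup ⟨S, hS, fun l => ?_⟩,
    fracFG_residueField hν.le_valuationRing hcomm h2⟩
  obtain ⟨g, hg, e⟩ := h1 l
  exact ⟨g, hg, hequiv.eq_iff.2 e⟩

end Center

end AbhyankarCenter

end

theorem mainTheorem5 {K : Type*} [Field K] (p : ℕ) [Fact p.Prime] [CharP K p]
    {Γ₀ : Type*} [LinearOrderedCommGroupWithZero Γ₀] (ν : Valuation K Γ₀)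
    (R : Type*) [CommRing R] [IsDomain R] [IsLocalRing R] [IsNoetherianRing R]
    [Algebra R K] [IsFractionRing R K]
    (hν : AbhyankarCenter.IsCenteredOn ν R)
    (hR : AbhyankarCenter.frobeniusDegree p (IsLocalRing.ResidueField R) < ⊤) :
    ∃ d : ℕ, ringKrullDim R = d ∧
      AbhyankarCenter.mulIndex p (AbhyankarCenter.ValueGroup ν) *
          AbhyankarCenter.frobeniusDegree p (AbhyankarCenter.ResidueField ν) ≤
        (p : ℕ∞) ^ d * AbhyankarCenter.frobeniusDegree p (IsLocalRing.ResidueField R) ∧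
      (AbhyankarCenter.IsAbhyankarCenter ν R ↔
        AbhyankarCenter.mulIndex p (AbhyankarCenter.ValueGroup ν) *
            AbhyankarCenter.frobeniusDegree p (AbhyankarCenter.ResidueField ν) =
          (p : ℕ∞) ^ d * AbhyankarCenter.frobeniusDegree p (IsLocalRing.ResidueField R)) := by
  open AbhyankarCenter in
  have hp : p.Prime := Fact.out
  let _ : Algebra (IsLocalRing.ResidueField R) (ResidueField ν) := hν.residueFieldMap.toAlgebra
  have : CharP (IsLocalRing.ResidueField R) p := charP_residueField (K := K) p R
  have : CharP (ResidueField ν) p := charP_residueField (K := K) p ν.valuationSubring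
  obtain ⟨d, r, t, y, hd, hr, ht, hy, hle, heq⟩ := hν.abhyankar rfl
  obtain ⟨n, hn, hn', hfrob⟩ := exists_finrank_of_frobeniusDegree hR
  obtain ⟨h1, h2⟩ := frobeniusDegree_le_and_eq hy hn hn'
  have h3 : mulIndex p (ValueGroup ν) ≤ (p ^ r : ℕ) := mulIndex_le hr.le
  have hprod : mulIndex p (ValueGroup ν) * frobeniusDegree p (ResidueField ν) ≤
      (p ^ (r + t) * n : ℕ) := by
    refine (mul_le_mul' h3 h1).trans_eq ?_
    push_cast
    ring
  have habh : IsAbhyankarCenter ν R ↔ r + t = d := by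
    have h4 : rationalRank (ValueGroup ν) = r := by rw [rationalRank_eq, hr]; simp
    have h5 : hν.residueTrdeg = t := by
      have : hν.residueTrdeg = Cardinal.toENat
        (Algebra.trdeg (IsLocalRing.ResidueField R) (ResidueField ν)) := rfl
      rw [this, ht]; simp
    have h6 : IsAbhyankarCenter ν R ↔
        ((rationalRank (ValueGroup ν) + hν.residueTrdeg : ℕ∞) : WithBot ℕ∞) = ringKrullDim R :=
      ⟨fun ⟨_, h⟩ => h, fun h => ⟨hν, h⟩⟩
    rw [h6, h4, h5, hd]
    norm_cast
  have hrhs : (p : ℕ∞) ^ d * frobeniusDegree p (IsLocalRing.ResidueField R) =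
      (p ^ d * n : ℕ) := by
    rw [hfrob]; push_cast; rfl
  refine ⟨d, hd, ?_, ?_⟩
  · rw [hrhs]
    refine hprod.trans ?_
    exact_mod_cast Nat.mul_le_mul_right n (Nat.pow_le_pow_right hp.pos hle)
  · rw [habh, hrhs]
    constructor
    · intro h
      obtain ⟨hfin, hfg⟩ := heq h
      have h7 : Module.finrank ℤ (ValueGroup ν) = r := by
        rw [Module.finrank, hr, Cardinal.toNat_natCast]
      rw [mulIndex_eq_of_finite, h7, h2 hfg, ← h]
      push_cast
      ring
    · intro h
      rw [h] at hprod
      have h8 : p ^ d * n ≤ p ^ (r + t) * n := by exact_mod_cast hprod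
      have h9 := Nat.le_of_mul_le_mul_right h8 (Nat.pos_of_ne_zero hn)
      exact le_antisymm hle ((Nat.pow_le_pow_iff_right hp.one_lt).1 h9)
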